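/- Consider the functional stochastic volatility model $$R_i(t)=g_i\int_0^t\sigma(u)\,dW_i(u),\quad t\in[0,1],\ i\in\mathbb Z,\qquad \log g_i=\varphi_1\log g_{i-1}+\dots+\varphi_p\log g_{i-p}+\varepsilon_i ,\quad i\in\mathbb Z,$$ on a probability space $(\Omega,\mathcal F,P)$, where $p\ge 1$ and the following hold. * The $\varepsilon_i$ are i.i.d. with mean zero and finite, nonzero variance. * $\varphi_p\ne0$ and $1-\varphi_1z-\dots-\varphi_pz^p\neq0$ for all complex $z$ with $|z|\le 1$. * (1) $\sigma:[0,1]\to[0,\infty)$ is deterministic, Borel measurable and bounded. * (2) The $g_i$ are almost surely positive, i.e. $g_i=\exp(x_i)$ for a real-valued random sequence $(x_i)$. * (3) The $W_i$, $i\in\mathbb Z$, are independent standard Brownian motions. * (4) The sequences $\{W_i\}$ and $\{g_i\}$ are independent. For the given $\{W_i\}$ and $\{\varepsilon_i\}$ it is accordingly assumed that $\{W_i\}$ and $\{\varepsilon_i\}$ are independent. Here $R_i$ is a random element of the space of continuous functions on $[0,1]$. The sequence $(R_i)$ is strictly stationary if $(R_{i+h})_{i\in\mathbb Z}$ has the same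 law as $(R_i)_{i\in\mathbb Z}$ for every $h\in\mathbb Z$. **(a) Existence and uniqueness.** For given $(\varphi_j)$, $\sigma$, $\{\varepsilon_i\}$, $\{W_i\}$ there is a strictly stationary sequence $(R_i)_{i\in\mathbb Z}$ which, with some sequence $(g_i)$ satisfying (2) and (4), satisfies both model equations. It is unique: any two such sequences agree almost surely, for all $i\in\mathbb Z$ and $t\in[0,1]$ simultaneously. **(b) $g_i$ is distinguishable from $\sigma$.** Suppose that $\sigma$ is nonzero on a set of positive Lebesgue measure, and let $(g_i,R_i)$ satisfy the model with $(R_i)$ strictly stationary. Let $(g'_i,R'_i)$ be a second sequence, possibly on another probability space, that satisfies a model of the same kind with its own $p',(\varphi'_j),\sigma',\{\varepsilon'_i\},\{W'_i\}$ under all the conditions above, with $(R'_i)$ strictly stationary. If, for some $i$, the random curves $R_i$ and $R_i'$ have the same law, then $\sigma'=\sigma$ almost everywhere on $[0,1]$, and there is one measurable functional $\Gamma$ on path space such that $g_i=\Gamma(R_i)$ and $g'_i=\Gamma(R'_i)$ almost surely. In particular $(g_i,R_i)$ and $(g'_i,R'_i)$ have the same law. -/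

import Mathlib

open MeasureTheory ProbabilityTheory Filter Topology
open scoped NNReal ENNReal

noncomputable section

namespace FunctionalSV

/-! ### The stochastic integral of a deterministic function -/

/-- A deterministic left-open step function `∑ k < n, c k • 1_{(τ k, τ (k + 1)]}` on `[0, 1]`. -/
structure StepFunction where
  n : ℕ
  τ : ℕ → unitInterval
  mono : Monotone τ
  c : ℕ → ℝ

/-- The function on `[0, 1]` given by a step function. -/
def StepFunction.eval (s : StepFunction) (u : unitInterval) : ℝ :=
  ∑ k ∈ Finset.range s.n, (Set.Ioc (s.τ k) (s.τ (k + 1))).indicator (fun _ => s.c k) u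

/-- The elementary integral `∑ k < n, c k * (B (τ (k + 1)) - B (τ k))`. -/
def StepFunction.integral {Ω : Type*} (s : StepFunction) (B : ℝ≥0 → Ω → ℝ) (ω : Ω) : ℝ :=
  ∑ k ∈ Finset.range s.n,
    s.c k * (B (unitInterval.toNNReal (s.τ (k + 1))) ω - B (unitInterval.toNNReal (s.τ k)) ω)

/-- `Y` is (a version of) the Itô integral `∫₀¹ f(u) dB(u)` of the deterministic square integrable
function `f`: the `L²(P)`-limit of the elementary integrals of a sequence of step functions which
converges to `f` in `L²([0, 1])`. For a Brownian motion `B` the limit does not depend on the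
sequence, by the Itô isometry. -/
def IsItoIntegral {Ω : Type*} [MeasurableSpace Ω] (P : Measure Ω) (B : ℝ≥0 → Ω → ℝ)
    (f : unitInterval → ℝ) (Y : Ω → ℝ) : Prop :=
  MemLp Y 2 P ∧ ∃ s : ℕ → StepFunction,
    Tendsto (fun m => eLpNorm (fun u => (s m).eval u - f u) 2 (volume : Measure unitInterval)) atTop (𝓝 0) ∧
    Tendsto (fun m => eLpNorm (fun ω => (s m).integral B ω - Y ω) 2 P) atTop (𝓝 0)

/-! ### The assumptions on the ingredients of the model -/

/-- `1 - φ₁ z - ⋯ - φ_p z ^ p` has degree `p ≥ 1` and no zero in the closed complex unit disk. -/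
def IsCausal (p : ℕ) (φ : ℕ → ℝ) : Prop :=
  1 ≤ p ∧ φ p ≠ 0 ∧
    ∀ z : ℂ, ‖z‖ ≤ 1 → 1 - ∑ j ∈ Finset.Icc 1 p, (φ j : ℂ) * z ^ j ≠ 0

/-- The volatility function is Borel measurable, nonnegative and bounded on `[0, 1]`. -/
structure IsVolatility (σ : unitInterval → ℝ) : Prop where
  measurable : Measurable σ
  nonneg : ∀ t, 0 ≤ σ t
  bddAbove : BddAbove (Set.range σ)

/-- Nondegenerate i.i.d. white noise: i.i.d., mean zero, finite nonzero variance. -/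
structure IsWhiteNoise {Ω : Type*} [MeasurableSpace Ω] (P : Measure Ω) (ε : ℤ → Ω → ℝ) :
    Prop where
  measurable : ∀ i, Measurable (ε i)
  iIndepFun : iIndepFun ε P
  identDistrib : ∀ i, IdentDistrib (ε i) (ε 0) P P
  memLp : MemLp (ε 0) 2 P
  mean_zero : ∫ ω, ε 0 ω ∂P = 0
  variance_pos : 0 < variance (ε 0) P

/-- The `W i` are independent standard Brownian motions. -/
structure IsBrownianSequence {Ω : Type*} [MeasurableSpace Ω] (P : Measure Ω)
    (W : ℤ → ℝ≥0 → Ω → ℝ) : Prop where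
  measurable : ∀ i t, Measurable (W i t)
  isBrownian : ∀ i, IsBrownianReal (W i) P
  iIndepFun : iIndepFun (fun i ω t => W i t ω) P

/-! ### The model -/

/-- `(g, R)` satisfies the model equations
`R_i(t) = g_i ∫₀ᵗ σ(u) dW_i(u)` and `log g_i = φ₁ log g_{i-1} + ⋯ + φ_p log g_{i-p} + ε_i`,
with almost surely positive `g_i`, with `{W_i}` independent of `{g_i}`, and with `R_i` a random
continuous function on `[0, 1]`. -/
structure IsSolution {Ω : Type*} [MeasurableSpace Ω] (P : Measure Ω) (p : ℕ) (φ : ℕ → ℝ)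
    (σ : unitInterval → ℝ) (ε : ℤ → Ω → ℝ) (W : ℤ → ℝ≥0 → Ω → ℝ)
    (g : ℤ → Ω → ℝ) (R : ℤ → unitInterval → Ω → ℝ) : Prop where
  measurable_g : ∀ i, Measurable (g i)
  pos_g : ∀ i, ∀ᵐ ω ∂P, 0 < g i ω
  indep : IndepFun (fun ω i t => W i t ω) (fun ω i => g i ω) P
  autoregression : ∀ i, ∀ᵐ ω ∂P,
    Real.log (g i ω) = ∑ j ∈ Finset.Icc 1 p, φ j * Real.log (g (i - (j : ℤ)) ω) + ε i ω
  measurable_R : ∀ i t, Measurable (R i t)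
  continuous_R : ∀ i ω, Continuous (fun t => R i t ω)
  integral_eq : ∀ i t, ∃ Y : Ω → ℝ,
    IsItoIntegral P (W i) ((Set.Iic t).indicator σ) Y ∧ ∀ᵐ ω ∂P, R i t ω = g i ω * Y ω

/-- Strict stationarity of a sequence of random functions: all shifted sequences have the same law.
Laws are taken on the product `σ`-algebra of the path space, which on continuous
functions coincides with the Borel `σ`-algebra of the uniform norm. -/
def IsStrictlyStationary {Ω : Type*} [MeasurableSpace Ω] (P : Measure Ω)
    (R : ℤ → unitInterval → Ω → ℝ) : Prop :=
  ∀ h : ℤ, P.map (fun ω i t => R (i + h) t ω) = P.map (fun ω i t => R i t ω)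

/-- A full specification of the model, with strictly stationary functional sequence `R`. -/
structure IsStationaryModel {Ω : Type*} [MeasurableSpace Ω] (P : Measure Ω) (p : ℕ) (φ : ℕ → ℝ)
    (σ : unitInterval → ℝ) (ε : ℤ → Ω → ℝ) (W : ℤ → ℝ≥0 → Ω → ℝ)
    (g : ℤ → Ω → ℝ) (R : ℤ → unitInterval → Ω → ℝ) : Prop where
  causal : IsCausal p φ
  volatility : IsVolatility σ
  noise : IsWhiteNoise P ε
  brownian : IsBrownianSequence P W
  solution : IsSolution P p φ σ ε W g R
  stationary : IsStrictlyStationary P R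

end FunctionalSV

end

/-! Write `I_i(t) = ∫₀ᵗ σ dW_i` and `V(t) = ∫₀ᵗ σ²` (`energy`), so that `R_i = g_i I_i`. Since `σ`
is deterministic, `I_i` is a Gaussian process with `Var I_i(t) = V(t)`, and both parts rest on a few
facts about it and about the autoregression.

Existence: causality puts the spectrum of the companion matrix inside the open unit disk, so `log
g_i` can be taken as an absolutely convergent moving average of the noise (`arSolution_eq`). Fourth
moments and dyadic chaining give `I_i` a continuous version that is one fixed measurable functional
of the path of `W_i` (`contIntegral`). Then `R` is a shift-equivariant functional of the stationary
pair `(W, ε)`, hence stationary.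

Uniqueness: only `R` is assumed stationary, not `g`. If `V(1) > 0`, then `log g_i = log |R_i(1)| -
log |I_i(1)|` is a difference of two tight sequences, hence tight. Its difference from the moving
average is a tight solution of the homogeneous recursion; going back `n` steps contracts it to zero
(`IsTightFamily.ae_eq_zero`, `IsSolution.log_ae_eq`). If `V(1) = 0`, all curves vanish.

Identification: the quadratic variation of `R_i` on `[0, t]` is `g_i² V(t)` almost surely
(`ae_quadVar_eq`). Ratios of quadratic variations therefore reveal `V(t) / V(1)`, and the level is
fixed by `E log g_i = 0`, which makes `log V(1)` the mean of the log quadratic variation. So the law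
of one curve determines `V`, hence `σ ≥ 0` almost everywhere, and `g_i` is the square root of the
quadratic variation over `V(1)`. The same formula serves both models, so equality of the laws of the
curves carries over to the pairs. -/

noncomputable section

namespace FunctionalSV

/-! ### Elementary integrals -/

/-- The linear extension of `t ↦ 1_{(0, t]}`. -/
def stepMap : (unitInterval →₀ ℝ) →ₗ[ℝ] (unitInterval → ℝ) :=
  Finsupp.linearCombination ℝ fun t => (Set.Ioc 0 t).indicator fun _ => (1 : ℝ)

/-- The linear extension of `t ↦ B t - B 0`. -/
def stepIntegral {Ω : Type*} (B : ℝ≥0 → Ω → ℝ) : (unitInterval →₀ ℝ) →ₗ[ℝ] (Ω → ℝ) :=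
  Finsupp.linearCombination ℝ fun t ω => B (unitInterval.toNNReal t) ω - B 0 ω

/-- The coefficients of a step function with respect to the functions `1_{(0, t]}`. -/
def StepFunction.coeffs (s : StepFunction) : unitInterval →₀ ℝ :=
  ∑ k ∈ Finset.range s.n, (Finsupp.single (s.τ (k + 1)) (s.c k) - Finsupp.single (s.τ k) (s.c k))

lemma stepMap_single (t : unitInterval) (a : ℝ) :
    stepMap (Finsupp.single t a) = (Set.Ioc 0 t).indicator fun _ => a := by
  ext u
  simp [stepMap, Set.indicator_apply]

lemma stepIntegral_single {Ω : Type*} (B : ℝ≥0 → Ω → ℝ) (t : unitInterval) (a : ℝ) :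
    stepIntegral B (Finsupp.single t a) =
      fun ω => a * (B (unitInterval.toNNReal t) ω - B 0 ω) := by
  ext u
  simp [stepIntegral]

/-- Rests on `1_(a,b] = 1_(0,b] - 1_(0,a]` for `a ≤ b`. Formal combinations of the `1_(0,t]` add and
scale freely, while adding two step functions would need a common partition; linear and bilinear
identities can thus be checked on generators. -/
lemma StepFunction.stepMap_coeffs (s : StepFunction) : stepMap s.coeffs = s.eval := by
  ext u
  simp only [coeffs, map_sum, map_sub, stepMap_single, Finset.sum_apply, Pi.sub_apply, eval]
  refine Finset.sum_congr rfl fun k _ => ?_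
  have h := s.mono (Nat.le_succ k)
  simp only [Set.indicator_apply, Set.mem_Ioc]
  have h0 : s.τ k < u → 0 < u := fun hu => (s.τ k).2.1.trans_lt hu
  have h1 : ¬ s.τ k < u ↔ u ≤ s.τ k := not_lt
  have h2 : u ≤ s.τ k → u ≤ s.τ (k + 1) := fun hu => hu.trans h
  by_cases a : s.τ k < u <;> by_cases b : u ≤ s.τ (k + 1) <;> by_cases c : 0 < u <;>
    simp_all

lemma StepFunction.stepIntegral_coeffs {Ω : Type*} (B : ℝ≥0 → Ω → ℝ) (s : StepFunction) :
    stepIntegral B s.coeffs = s.integral B := by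
  ext ω
  simp only [coeffs, map_sum, map_sub, stepIntegral_single, Finset.sum_apply, Pi.sub_apply,
    integral]
  refine Finset.sum_congr rfl fun k _ => ?_
  ring

/-- Elementary integrals depend on the path alone, which later allows the integral to be a
functional on path space. -/
lemma stepIntegral_comp {Ω : Type*} (B : ℝ≥0 → Ω → ℝ) (x : unitInterval →₀ ℝ) (ω : Ω) :
    stepIntegral (fun t (w : ℝ≥0 → ℝ) => w t) x (fun t => B t ω) = stepIntegral B x ω := by
  simp [stepIntegral, Finsupp.linearCombination_apply, Finsupp.sum, Finset.sum_apply]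

lemma measurable_stepIntegral {Ω : Type*} [MeasurableSpace Ω] {B : ℝ≥0 → Ω → ℝ}
    (hB : ∀ t, Measurable (B t)) (x : unitInterval →₀ ℝ) : Measurable (stepIntegral B x) := by
  induction x using Finsupp.induction_linear with
  | zero => simpa using measurable_zero
  | add x y hx hy => simpa using hx.add hy
  | single t a =>
    rw [stepIntegral_single]
    exact ((hB _).sub (hB _)).const_mul _

lemma memLp_stepMap (x : unitInterval →₀ ℝ) (p : ℝ≥0∞) : MemLp (stepMap x) p volume := by
  induction x using Finsupp.induction_linear with
  | zero => simp
  | add x y hx hy => simpa using hx.add hy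
  | single t a =>
    rw [stepMap_single]
    exact (memLp_const a).indicator measurableSet_Ioc

/-! ### Itô isometry and Gaussian law for elementary integrals. -/

section Brownian

variable {Ω : Type*} [MeasurableSpace Ω] {P : Measure Ω} {B : ℝ≥0 → Ω → ℝ}

lemma memLp_stepIntegral (hB : IsPreBrownianReal B P) (x : unitInterval →₀ ℝ) :
    MemLp (stepIntegral B x) 2 P := by
  have h (t : ℝ≥0) : MemLp (B t) 2 P := (hB.isGaussianProcess.hasGaussianLaw_eval t).memLp_two
  induction x using Finsupp.induction_linear with
  | zero => simp
  | add x y hx hy => simpa using hx.add hy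
  | single t a =>
    rw [stepIntegral_single]
    exact ((h _).sub (h _)).const_mul a

lemma integral_stepIntegral (hB : IsPreBrownianReal B P) (x : unitInterval →₀ ℝ) :
    ∫ ω, stepIntegral B x ω ∂P = 0 := by
  have : IsProbabilityMeasure P := hB.isGaussianProcess.isProbabilityMeasure
  induction x using Finsupp.induction_linear with
  | zero => simp
  | add x y hx hy =>
    simp only [map_add, Pi.add_apply]
    rw [integral_add ((memLp_stepIntegral hB x).integrable one_le_two)
      ((memLp_stepIntegral hB y).integrable one_le_two), hx, hy, add_zero]
  | single t a =>
    simp only [stepIntegral_single]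
    rw [integral_const_mul, integral_sub (hB.integrable_eval _) (hB.integrable_eval _),
      hB.integral_eval, hB.integral_eval]
    simp

/-- The Itô isometry. Both sides are bilinear, so generators suffice, and there it is the Brownian
covariance: `E[B_t B_s] = min t s` is the length of `(0,t] ∩ (0,s]`. -/
lemma integral_stepIntegral_mul (hB : IsPreBrownianReal B P) (x y : unitInterval →₀ ℝ) :
    ∫ ω, stepIntegral B x ω * stepIntegral B y ω ∂P = ∫ u, stepMap x u * stepMap y u := by
  have : IsProbabilityMeasure P := hB.isGaussianProcess.isProbabilityMeasure
  have h (t : ℝ≥0) : MemLp (B t) 2 P := (hB.isGaussianProcess.hasGaussianLaw_eval t).memLp_two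
  induction x using Finsupp.induction_linear with
  | zero => simp
  | add x x' hx hx' =>
    simp only [map_add, Pi.add_apply, add_mul]
    rw [integral_add, integral_add, hx, hx']
    · exact (memLp_stepMap x 2).integrable_mul (memLp_stepMap y 2)
    · exact (memLp_stepMap x' 2).integrable_mul (memLp_stepMap y 2)
    · exact (memLp_stepIntegral hB x).integrable_mul (memLp_stepIntegral hB y)
    · exact (memLp_stepIntegral hB x').integrable_mul (memLp_stepIntegral hB y)
  | single t a =>
    induction y using Finsupp.induction_linear with
    | zero => simp
    | add y y' hy hy' =>
      simp only [map_add, Pi.add_apply, mul_add]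
      rw [integral_add, integral_add, hy, hy']
      · exact (memLp_stepMap _ 2).integrable_mul (memLp_stepMap y 2)
      · exact (memLp_stepMap _ 2).integrable_mul (memLp_stepMap y' 2)
      · exact (memLp_stepIntegral hB _).integrable_mul (memLp_stepIntegral hB y)
      · exact (memLp_stepIntegral hB _).integrable_mul (memLp_stepIntegral hB y')
    | single s b =>
      have h0 : ∀ᵐ ω ∂P, B 0 ω = 0 := hB.eval_zero_ae_eq_zero
      have e1 : ∫ ω, stepIntegral B (Finsupp.single t a) ω *
            stepIntegral B (Finsupp.single s b) ω ∂P
          = a * b * ∫ ω, B (unitInterval.toNNReal t) ω * B (unitInterval.toNNReal s) ω ∂P := by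
        rw [← integral_const_mul]
        refine integral_congr_ae ?_
        filter_upwards [h0] with ω hω
        simp only [stepIntegral_single, hω]
        ring
      have e2 := hB.covariance_eval (unitInterval.toNNReal t) (unitInterval.toNNReal s)
      rw [covariance_eq_sub (h _) (h _), hB.integral_eval, hB.integral_eval] at e2
      simp only [Pi.mul_apply, mul_zero, sub_zero] at e2
      have e3 : ∀ u, stepMap (Finsupp.single t a) u * stepMap (Finsupp.single s b) u =
          (Set.Ioc 0 (min t s)).indicator (fun _ => a * b) u := by
        intro u
        simp only [stepMap_single, Set.indicator_apply, Set.mem_Ioc, le_min_iff]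
        grind
      simp only [e1, e2, e3]
      rw [integral_indicator measurableSet_Ioc, setIntegral_const, Measure.real,
        unitInterval.volume_Ioc, ENNReal.toReal_ofReal (by simpa using (min t s).2.1)]
      simp only [smul_eq_mul]
      rw [mul_comm]
      congr 1
      rcases le_total t s with hts | hts
      · have : unitInterval.toNNReal t ≤ unitInterval.toNNReal s := hts
        simp [min_eq_left hts, min_eq_left this]
      · have : unitInterval.toNNReal s ≤ unitInterval.toNNReal t := hts
        simp [min_eq_right hts, min_eq_right this]

lemma hasGaussianLaw_stepIntegral (hB : IsPreBrownianReal B P) (x : unitInterval →₀ ℝ) :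
    HasGaussianLaw (stepIntegral B x) P := by
  have h : IsGaussianProcess (fun (t : unitInterval) ω =>
      x t * (B (unitInterval.toNNReal t) ω - B 0 ω)) P := by
    refine hB.isGaussianProcess.of_isGaussianProcess fun t =>
      ⟨{unitInterval.toNNReal t, 0},
        { toFun z := x t * (z ⟨unitInterval.toNNReal t, by simp⟩ - z ⟨0, by simp⟩)
          map_add' z z' := by simp; ring
          map_smul' c z := by simp; ring }, by simp⟩
  have h' := h.hasGaussianLaw_sum (I := x.support)
  have e : stepIntegral B x = ∑ t ∈ x.support, fun ω =>
      x t * (B (unitInterval.toNNReal t) ω - B 0 ω) := by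
    ext ω
    simp [stepIntegral, Finsupp.linearCombination_apply, Finsupp.sum, Finset.sum_apply]
  rw [e]
  exact h'

lemma hasLaw_stepIntegral (hB : IsPreBrownianReal B P) (x : unitInterval →₀ ℝ) :
    HasLaw (stepIntegral B x) (gaussianReal 0 (∫ u, stepMap x u ^ 2).toNNReal) P := by
  have h := hasGaussianLaw_stepIntegral hB x
  refine ⟨h.aemeasurable, ?_⟩
  rw [h.map_eq_gaussianReal, integral_stepIntegral hB,
    variance_of_integral_eq_zero h.aemeasurable (integral_stepIntegral hB x)]
  congr 2
  simpa [sq] using integral_stepIntegral_mul hB x x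

end Brownian

/-! ### Integrals of square integrable functions -/

lemma toReal_eLpNorm_two_sq {α : Type*} [MeasurableSpace α] {μ : Measure α} {f : α → ℝ}
    (hf : MemLp f 2 μ) : (eLpNorm f 2 μ).toReal ^ 2 = ∫ x, f x ^ 2 ∂μ := by
  have h0 : 0 ≤ ∫ x, f x ^ 2 ∂μ := integral_nonneg fun x => sq_nonneg _
  rw [hf.eLpNorm_eq_integral_rpow_norm (by simp) (by simp)]
  simp only [ENNReal.toReal_ofNat, Real.rpow_ofNat, Real.norm_eq_abs, sq_abs]
  rw [ENNReal.toReal_ofReal (by positivity), ← Real.rpow_natCast, ← Real.rpow_mul h0]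
  norm_num

lemma tendsto_integral_sq_of_eLpNorm {α : Type*} [MeasurableSpace α] {μ : Measure α}
    {F : ℕ → α → ℝ} {f : α → ℝ} (hF : ∀ m, MemLp (F m) 2 μ) (hf : MemLp f 2 μ)
    (h : Tendsto (fun m => eLpNorm (F m - f) 2 μ) atTop (𝓝 0)) :
    Tendsto (fun m => ∫ x, F m x ^ 2 ∂μ) atTop (𝓝 (∫ x, f x ^ 2 ∂μ)) := by
  have h1 := ((Lp.tendsto_Lp_iff_tendsto_eLpNorm'' F hF f hf).2 h).norm.pow 2
  simpa only [Lp.norm_toLp, toReal_eLpNorm_two_sq (hF _), toReal_eLpNorm_two_sq hf] using h1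

/-- `Y` is an `L²`-limit of elementary integrals whose integrands converge to `f` in `L²`. -/
structure IsWiener {Ω : Type*} [MeasurableSpace Ω] (P : Measure Ω) (B : ℝ≥0 → Ω → ℝ)
    (f : unitInterval → ℝ) (Y : Ω → ℝ) : Prop where
  memLp_fun : MemLp f 2 volume
  memLp : MemLp Y 2 P
  exists_seq : ∃ x : ℕ → (unitInterval →₀ ℝ),
    Tendsto (fun m => eLpNorm (stepMap (x m) - f) 2 volume) atTop (𝓝 0) ∧
    Tendsto (fun m => eLpNorm (stepIntegral B (x m) - Y) 2 P) atTop (𝓝 0)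

section Wiener

variable {Ω : Type*} [MeasurableSpace Ω] {P : Measure Ω} {B : ℝ≥0 → Ω → ℝ}
  {f g : unitInterval → ℝ} {Y Z : Ω → ℝ}

/-- Passing to formal combinations makes the class of integrals visibly closed under linear
operations. -/
lemma IsItoIntegral.isWiener (h : IsItoIntegral P B f Y) (hf : MemLp f 2 volume) :
    IsWiener P B f Y := by
  obtain ⟨hY, s, h1, h2⟩ := h
  refine ⟨hf, hY, fun m => (s m).coeffs, ?_, ?_⟩
  · simp only [StepFunction.stepMap_coeffs]
    exact h1
  · simp only [StepFunction.stepIntegral_coeffs]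
    exact h2

lemma IsWiener.add (hB : IsPreBrownianReal B P) (hf : IsWiener P B f Y) (hg : IsWiener P B g Z) :
    IsWiener P B (f + g) (Y + Z) := by
  obtain ⟨x, hx, hx'⟩ := hf.exists_seq
  obtain ⟨y, hy, hy'⟩ := hg.exists_seq
  refine ⟨hf.memLp_fun.add hg.memLp_fun, hf.memLp.add hg.memLp, fun m => x m + y m, ?_, ?_⟩
  · refine tendsto_of_tendsto_of_tendsto_of_le_of_le tendsto_const_nhds
      (by simpa using hx.add hy) (fun _ => zero_le) fun m => ?_
    rw [map_add, add_sub_add_comm]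
    exact eLpNorm_add_le ((memLp_stepMap _ 2).sub hf.memLp_fun).1
      ((memLp_stepMap _ 2).sub hg.memLp_fun).1 one_le_two
  · refine tendsto_of_tendsto_of_tendsto_of_le_of_le tendsto_const_nhds
      (by simpa using hx'.add hy') (fun _ => zero_le) fun m => ?_
    rw [map_add, add_sub_add_comm]
    exact eLpNorm_add_le ((memLp_stepIntegral hB _).sub hf.memLp).1
      ((memLp_stepIntegral hB _).sub hg.memLp).1 one_le_two

lemma IsWiener.const_smul (c : ℝ) (hf : IsWiener P B f Y) : IsWiener P B (c • f) (c • Y) := by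
  obtain ⟨x, hx, hx'⟩ := hf.exists_seq
  refine ⟨hf.memLp_fun.const_smul c, hf.memLp.const_smul c, fun m => c • x m, ?_, ?_⟩
  · simp_rw [map_smul, ← smul_sub, eLpNorm_const_smul]
    simpa using ENNReal.Tendsto.const_mul hx (Or.inr (by simp : ‖c‖ₑ ≠ ⊤))
  · simp_rw [map_smul, ← smul_sub, eLpNorm_const_smul]
    simpa using ENNReal.Tendsto.const_mul hx' (Or.inr (by simp : ‖c‖ₑ ≠ ⊤))

lemma IsWiener.sub (hB : IsPreBrownianReal B P) (hf : IsWiener P B f Y) (hg : IsWiener P B g Z) :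
    IsWiener P B (f - g) (Y - Z) := by
  simpa [sub_eq_add_neg] using hf.add hB (hg.const_smul (-1))

lemma IsWiener.congr_ae (hf : IsWiener P B f Y) (h : Y =ᵐ[P] Z) : IsWiener P B f Z := by
  obtain ⟨x, hx, hx'⟩ := hf.exists_seq
  refine ⟨hf.memLp_fun, hf.memLp.ae_eq h, x, hx, ?_⟩
  convert hx' using 2 with m
  exact eLpNorm_congr_ae (h.symm.mono fun u hu => by simp [hu])

lemma IsWiener.integral_sq (hB : IsPreBrownianReal B P) (hf : IsWiener P B f Y) :
    ∫ ω, Y ω ^ 2 ∂P = ∫ u, f u ^ 2 := by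
  obtain ⟨x, hx, hx'⟩ := hf.exists_seq
  have h1 := tendsto_integral_sq_of_eLpNorm (fun m => memLp_stepMap (x m) 2) hf.memLp_fun hx
  have h2 := tendsto_integral_sq_of_eLpNorm (fun m => memLp_stepIntegral hB (x m)) hf.memLp hx'
  refine tendsto_nhds_unique h2 (h1.congr fun m => ?_)
  simpa only [sq] using (integral_stepIntegral_mul hB (x m) (x m)).symm

/-- The integral of `f` is Gaussian with variance `∫ f²`. -/
lemma IsWiener.hasLaw (hB : IsPreBrownianReal B P) (hf : IsWiener P B f Y) :
    HasLaw Y (gaussianReal 0 (∫ u, f u ^ 2).toNNReal) P := by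
  have : IsProbabilityMeasure P := hB.isGaussianProcess.isProbabilityMeasure
  obtain ⟨x, hx, hx'⟩ := hf.exists_seq
  refine ⟨hf.memLp.1.aemeasurable, ?_⟩
  have h1 := (tendsto_integral_sq_of_eLpNorm (fun m => memLp_stepMap (x m) 2) hf.memLp_fun hx)
  -- `L²` convergence implies convergence in law, and the variances converge by `h1`. So the
  -- characteristic functions `exp(-v_m t² / 2)` tend both to that of `Y` and to the Gaussian one.
  have h2 : TendstoInDistribution (fun m => stepIntegral B (x m)) atTop Y (fun _ => P) P :=
    (tendstoInMeasure_of_tendsto_eLpNorm two_ne_zero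
      (fun m => (memLp_stepIntegral hB (x m)).1) hf.memLp.1 hx').tendstoInDistribution
      fun m => (memLp_stepIntegral hB (x m)).1.aemeasurable
  have hm : IsProbabilityMeasure (P.map Y) := Measure.isProbabilityMeasure_map
    hf.memLp.1.aemeasurable
  refine Measure.ext_of_charFun ?_
  ext t
  have h3 := (ProbabilityMeasure.tendsto_iff_tendsto_charFun.1 h2.tendsto) t
  refine tendsto_nhds_unique h3 ?_
  simp only [ProbabilityMeasure.coe_mk, (hasLaw_stepIntegral hB (x _)).map_eq,
    charFun_gaussianReal, Complex.ofReal_zero, mul_zero, zero_mul, zero_sub]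
  refine (Complex.continuous_exp.tendsto _).comp (Tendsto.neg (Tendsto.div_const
    (Tendsto.mul_const _ ?_) _))
  refine (Complex.continuous_ofReal.tendsto _).comp ?_
  exact (NNReal.continuous_coe.tendsto _).comp ((continuous_real_toNNReal.tendsto _).comp h1)

/-- By the isometry, `Y - Z` is an integral of `f - f = 0` and so has second moment zero. -/
lemma IsWiener.ae_eq (hB : IsPreBrownianReal B P) (hf : IsWiener P B f Y)
    (hf' : IsWiener P B f Z) : Y =ᵐ[P] Z := by
  have h := (hf.sub hB hf').integral_sq hB
  simp only [sub_self, Pi.zero_apply, ne_eq, OfNat.ofNat_ne_zero, not_false_eq_true, zero_pow,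
    integral_zero] at h
  rw [integral_eq_zero_iff_of_nonneg (fun _ => sq_nonneg _)
    (hf.memLp.sub hf'.memLp).integrable_sq] at h
  filter_upwards [h] with ω hω
  simpa [sub_eq_zero] using hω

end Wiener

/-! ### Density of step functions -/

/-- The point `k / n`, truncated to `[0, 1]`. -/
def gridPoint (n k : ℕ) : unitInterval :=
  ⟨min (k / n) 1, le_min (by positivity) zero_le_one, min_le_right _ _⟩

lemma coe_gridPoint (n k : ℕ) : (gridPoint n k : ℝ) = min ((k : ℝ) / n) 1 := rfl

lemma coe_gridPoint_of_le {n k : ℕ} (h : k ≤ n) : (gridPoint n k : ℝ) = (k : ℝ) / n := by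
  rw [coe_gridPoint, min_eq_left]
  exact div_le_one_of_le₀ (by exact_mod_cast h) (by positivity)

lemma monotone_gridPoint (n : ℕ) : Monotone (gridPoint n) := fun k l h => by
  rw [← Subtype.coe_le_coe, coe_gridPoint, coe_gridPoint]
  gcongr

/-- The step function with value `g (k / n)` on `((k - 1) / n, k / n]`. -/
def gridStep (g : unitInterval → ℝ) (n : ℕ) : StepFunction where
  n := n
  τ := gridPoint n
  mono := monotone_gridPoint n
  c k := g (gridPoint n (k + 1))

/-- The witness is the right endpoint `⌈n u⌉ / n` of the left-open cell containing `u`. The point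
`0` lies in no cell and is excluded; it is a null set. -/
lemma exists_gridStep_eval_eq (g : unitInterval → ℝ) {n : ℕ} (hn : 0 < n) {u : unitInterval}
    (hu : 0 < u) : ∃ v : unitInterval, (u : ℝ) ≤ v ∧ (v : ℝ) ≤ u + 1 / n ∧
      (gridStep g n).eval u = g v := by
  have hn' : (0 : ℝ) < n := by exact_mod_cast hn
  have hu' : (0 : ℝ) < u := hu
  have hu1 : (u : ℝ) ≤ 1 := u.2.2
  obtain ⟨k, hk⟩ : ∃ k, ⌈(n : ℝ) * u⌉₊ = k + 1 :=
    Nat.exists_eq_succ_of_ne_zero (Nat.ceil_pos.2 (by positivity)).ne'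
  obtain ⟨h1, h2⟩ := (Nat.ceil_eq_iff (Nat.succ_ne_zero k)).1 hk
  have hkn : k + 1 ≤ n := by
    rw [← hk, Nat.ceil_le]
    nlinarith
  simp only [Nat.succ_eq_add_one, add_tsub_cancel_right, Nat.cast_add, Nat.cast_one] at h1 h2
  have e1 : (gridPoint n (k + 1) : ℝ) = (k + 1) / n := by
    rw [coe_gridPoint_of_le hkn]
    simp
  refine ⟨gridPoint n (k + 1), ?_, ?_, ?_⟩
  · rw [e1, le_div_iff₀ hn']
    linarith
  · rw [e1, div_le_iff₀ hn', add_mul, div_mul_cancel₀ _ hn'.ne']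
    linarith
  · rw [StepFunction.eval]
    refine (Finset.sum_eq_single k ?_ ?_).trans ?_
    · intro j hj hjk
      rw [Set.indicator_of_notMem]
      rintro ⟨h3, h4⟩
      have hjn : j < n := Finset.mem_range.1 hj
      have h3' : (gridPoint n j : ℝ) < u := h3
      have h4' : (u : ℝ) ≤ gridPoint n (j + 1) := h4
      rw [coe_gridPoint_of_le hjn.le, div_lt_iff₀ hn'] at h3'
      rw [coe_gridPoint_of_le hjn, le_div_iff₀ hn'] at h4'
      have h5 : (j : ℝ) < k + 1 := by linarith
      have h6 : (k : ℝ) < (j + 1 : ℕ) := by linarith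
      have h5' : j < k + 1 := by exact_mod_cast h5
      have h6' : k < j + 1 := by exact_mod_cast h6
      omega
    · intro h
      exact absurd (Finset.mem_range.2 (by exact hkn)) h
    · rw [Set.indicator_of_mem]
      · rfl
      constructor
      · rw [← Subtype.coe_lt_coe]
        change (gridPoint n k : ℝ) < u
        rw [coe_gridPoint_of_le (by omega), div_lt_iff₀ hn']
        linarith
      · rw [← Subtype.coe_le_coe]
        change (u : ℝ) ≤ gridPoint n (k + 1)
        rw [e1, le_div_iff₀ hn']
        linarith

lemma StepFunction.memLp_eval (s : StepFunction) (p : ℝ≥0∞) : MemLp s.eval p volume := by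
  rw [← s.stepMap_coeffs]
  exact memLp_stepMap _ _

/-- Continuous functions are dense in `L²`, and on the compact interval they are uniformly
continuous, so sampling them on a fine grid costs little even in sup norm. -/
lemma exists_stepFunction_eLpNorm_sub_le {f : unitInterval → ℝ} (hf : MemLp f 2 volume)
    {η : ℝ} (hη : 0 < η) :
    ∃ s : StepFunction, eLpNorm (s.eval - f) 2 volume ≤ ENNReal.ofReal η := by
  obtain ⟨g, hg, hg'⟩ := hf.exists_boundedContinuous_eLpNorm_sub_le (by simp)
    (ε := ENNReal.ofReal (η / 2)) (by simpa using hη)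
  have huc : UniformContinuous g := CompactSpace.uniformContinuous_of_continuous g.continuous
  obtain ⟨δ, hδ, hgδ⟩ := Metric.uniformContinuous_iff.1 huc (η / 2) (by positivity)
  obtain ⟨n, hn⟩ := exists_nat_one_div_lt hδ
  refine ⟨gridStep g (n + 1), ?_⟩
  have h1 : eLpNorm ((gridStep g (n + 1)).eval - ⇑g) 2 volume ≤ ENNReal.ofReal (η / 2) := by
    refine (eLpNorm_le_of_ae_bound (C := η / 2) ?_).trans (by simp)
    have h0 : ∀ᵐ u : unitInterval, u ≠ 0 := by
      rw [ae_iff]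
      simp
    filter_upwards [h0] with u hu
    obtain ⟨v, hv1, hv2, hv3⟩ := exists_gridStep_eval_eq g n.succ_pos
      (lt_of_le_of_ne u.2.1 (Ne.symm hu) : 0 < u)
    rw [Pi.sub_apply, hv3, ← dist_eq_norm]
    refine (hgδ ?_).le
    rw [Subtype.dist_eq, Real.dist_eq, abs_of_nonneg (by linarith)]
    push_cast at hv2
    linarith
  calc eLpNorm ((gridStep g (n + 1)).eval - f) 2 volume
      = eLpNorm (((gridStep g (n + 1)).eval - ⇑g) - (f - ⇑g)) 2 volume := by
        rw [sub_sub_sub_cancel_right]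
    _ ≤ eLpNorm ((gridStep g (n + 1)).eval - ⇑g) 2 volume + eLpNorm (f - ⇑g) 2 volume :=
        eLpNorm_sub_le (((gridStep g (n + 1)).memLp_eval 2).sub hg').1 (hf.sub hg').1 one_le_two
    _ ≤ ENNReal.ofReal (η / 2) + ENNReal.ofReal (η / 2) := add_le_add h1 hg
    _ = ENNReal.ofReal η := by
        rw [← ENNReal.ofReal_add (by positivity) (by positivity), add_halves]

/-! ### The integral as a functional of the path -/

/-- Step functions converging to `f` in `L²` at a geometric rate. -/
def approxStep (f : unitInterval → ℝ) (m : ℕ) : StepFunction :=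
  open scoped Classical in
  if hf : MemLp f 2 volume then
    (exists_stepFunction_eLpNorm_sub_le hf (by positivity : (0 : ℝ) < (1 / 2) ^ m)).choose
  else ⟨0, fun _ => 0, monotone_const, 0⟩

lemma eLpNorm_approxStep_sub_le {f : unitInterval → ℝ} (hf : MemLp f 2 volume) (m : ℕ) :
    eLpNorm ((approxStep f m).eval - f) 2 volume ≤ ENNReal.ofReal ((1 / 2) ^ m) := by
  rw [approxStep, dif_pos hf]
  exact (exists_stepFunction_eLpNorm_sub_le hf (by positivity : (0 : ℝ) < (1 / 2) ^ m)).choose_spec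

/-- The Wiener integral of `f` as a measurable functional of the path of the integrator. -/
def wienerIntegral (f : unitInterval → ℝ) (w : ℝ≥0 → ℝ) : ℝ :=
  limsup (fun m => stepIntegral (fun t (w : ℝ≥0 → ℝ) => w t) (approxStep f m).coeffs w) atTop

lemma measurable_wienerIntegral (f : unitInterval → ℝ) : Measurable (wienerIntegral f) :=
  Measurable.limsup fun _ => measurable_stepIntegral (fun t => measurable_pi_apply t) _

lemma eLpNorm_stepIntegral {Ω : Type*} [MeasurableSpace Ω] {P : Measure Ω} {B : ℝ≥0 → Ω → ℝ}
    (hB : IsPreBrownianReal B P) (x : unitInterval →₀ ℝ) :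
    eLpNorm (stepIntegral B x) 2 P = eLpNorm (stepMap x) 2 volume := by
  rw [← ENNReal.toReal_eq_toReal_iff' (memLp_stepIntegral hB x).2.ne (memLp_stepMap x 2).2.ne,
    ← pow_left_inj₀ ENNReal.toReal_nonneg ENNReal.toReal_nonneg two_ne_zero,
    toReal_eLpNorm_two_sq (memLp_stepIntegral hB x), toReal_eLpNorm_two_sq (memLp_stepMap x 2)]
  simpa only [sq] using integral_stepIntegral_mul hB x x

/-- The geometric rate of `approxStep` makes the errors summable, so the elementary integrals
converge almost surely as well as in `L²`, and the limsup defining `wienerIntegral` is a true limit.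
One measurable functional thus serves every Brownian motion. -/
theorem isItoIntegral_wienerIntegral {Ω : Type*} [MeasurableSpace Ω] {P : Measure Ω}
    {B : ℝ≥0 → Ω → ℝ} (hB : IsPreBrownianReal B P) {f : unitInterval → ℝ}
    (hf : MemLp f 2 volume) :
    IsItoIntegral P B f (fun ω => wienerIntegral f (fun t => B t ω)) := by
  set x : ℕ → (unitInterval →₀ ℝ) := fun m => (approxStep f m).coeffs with hx
  have hb (m : ℕ) : eLpNorm (stepMap (x m) - f) 2 volume ≤ ENNReal.ofReal ((1 / 2) ^ m) := by
    simpa only [hx, StepFunction.stepMap_coeffs] using eLpNorm_approxStep_sub_le hf m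
  -- Two errors of at most `(1/2)^N` each would give the factor 2; the Cauchy criterion wants a
  -- strict inequality, hence 3.
  have hsum : ∑' N : ℕ, ENNReal.ofReal (3 * (1 / 2) ^ N) ≠ ∞ := by
    rw [← ENNReal.ofReal_tsum_of_nonneg (fun _ => by positivity)
      (summable_geometric_two.mul_left 3)]
    exact ENNReal.ofReal_ne_top
  have hcau (N n m : ℕ) (hn : N ≤ n) (hm : N ≤ m) :
      eLpNorm (stepIntegral B (x n) - stepIntegral B (x m)) 2 P <
        ENNReal.ofReal (3 * (1 / 2) ^ N) := by
    rw [← map_sub, eLpNorm_stepIntegral hB, map_sub]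
    calc eLpNorm (stepMap (x n) - stepMap (x m)) 2 volume
        = eLpNorm ((stepMap (x n) - f) - (stepMap (x m) - f)) 2 volume := by
          rw [sub_sub_sub_cancel_right]
      _ ≤ eLpNorm (stepMap (x n) - f) 2 volume + eLpNorm (stepMap (x m) - f) 2 volume :=
          eLpNorm_sub_le ((memLp_stepMap _ 2).sub hf).1 ((memLp_stepMap _ 2).sub hf).1 one_le_two
      _ ≤ ENNReal.ofReal ((1 / 2) ^ n) + ENNReal.ofReal ((1 / 2) ^ m) := add_le_add (hb n) (hb m)
      _ ≤ ENNReal.ofReal ((1 / 2) ^ N + (1 / 2) ^ N) := by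
          rw [← ENNReal.ofReal_add (by positivity) (by positivity)]
          refine ENNReal.ofReal_le_ofReal (add_le_add ?_ ?_) <;>
            exact pow_le_pow_of_le_one (by norm_num) (by norm_num) ‹_›
      _ < ENNReal.ofReal (3 * (1 / 2) ^ N) := by
          have : (0 : ℝ) < (1 / 2) ^ N := by positivity
          rw [ENNReal.ofReal_lt_ofReal_iff (by positivity)]
          linarith
  have hmem (m : ℕ) := memLp_stepIntegral hB (x m)
  obtain ⟨Y, hY, hYlim⟩ := Lp.cauchy_complete_eLpNorm one_le_two hmem hsum hcau
  have hae := Lp.ae_tendsto_of_cauchy_eLpNorm (fun m => (hmem m).1) one_le_two hsum hcau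
  have hP : IsProbabilityMeasure P := hB.isGaussianProcess.isProbabilityMeasure
  have hlim : ∀ᵐ ω ∂P, Tendsto (fun m => stepIntegral B (x m) ω) atTop
      (𝓝 (wienerIntegral f (fun t => B t ω))) := by
    filter_upwards [hae] with ω ⟨l, hl⟩
    rw [wienerIntegral]
    simp only [stepIntegral_comp]
    rwa [hl.limsup_eq]
  have heq : Y =ᵐ[P] fun ω => wienerIntegral f (fun t => B t ω) :=
    tendstoInMeasure_ae_unique
      (tendstoInMeasure_of_tendsto_eLpNorm two_ne_zero (fun m => (hmem m).1) hY.1 hYlim)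
      (tendstoInMeasure_of_tendsto_ae (fun m => (hmem m).1) hlim)
  refine ⟨hY.ae_eq heq, approxStep f, ?_, ?_⟩
  · refine tendsto_of_tendsto_of_tendsto_of_le_of_le tendsto_const_nhds ?_ (fun _ => zero_le)
      (eLpNorm_approxStep_sub_le hf)
    rw [← ENNReal.ofReal_zero]
    exact (ENNReal.continuous_ofReal.tendsto 0).comp
      (tendsto_pow_atTop_nhds_zero_of_lt_one (by norm_num) (by norm_num))
  · refine hYlim.congr fun m => ?_
    rw [← StepFunction.stepIntegral_coeffs]
    exact eLpNorm_congr_ae (heq.mono fun ω hω => by simp [hω, hx])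

/-! ### Fourth moments -/

/-- The fourth moment is the fourth derivative at `0` of the moment generating function `exp(v t² /
2)`. -/
lemma integral_pow_four_gaussianReal (v : ℝ≥0) :
    ∫ x, x ^ 4 ∂(gaussianReal 0 v) = 3 * (v : ℝ) ^ 2 := by
  have h := iteratedDeriv_mgf_zero (X := id) (μ := gaussianReal 0 v) (by simp) 4
  simp only [mgf_id_gaussianReal, zero_mul, zero_add, Pi.pow_apply, id_eq] at h
  rw [← h]
  set c : ℝ := (v : ℝ)
  have he (t : ℝ) : HasDerivAt (fun t => Real.exp (c * t ^ 2 / 2))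
      (Real.exp (c * t ^ 2 / 2) * (c * t)) t := by
    have := (((hasDerivAt_pow 2 t).const_mul c).div_const 2).exp
    convert this using 1
    simp only [Nat.cast_ofNat, Nat.add_one_sub_one, pow_one]
    ring
  -- Differentiation preserves the form `q(t) exp(c t² / 2)` and sends `q` to `q' + c t q`.
  have hp (q : ℝ → ℝ) (q' : ℝ → ℝ) (hq : ∀ t, HasDerivAt q (q' t) t) :
      deriv (fun t => q t * Real.exp (c * t ^ 2 / 2)) =
        fun t => (q' t + q t * (c * t)) * Real.exp (c * t ^ 2 / 2) := by
    ext t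
    refine ((hq t).mul (he t)).deriv.trans ?_
    ring
  have h1 : deriv (fun t => Real.exp (c * t ^ 2 / 2)) =
      fun t => (c * t) * Real.exp (c * t ^ 2 / 2) := by
    ext t
    rw [(he t).deriv]
    ring
  have d1 (t : ℝ) : HasDerivAt (fun t => c * t) c t := by
    simpa using (hasDerivAt_id t).const_mul c
  have d2 (t : ℝ) : HasDerivAt (fun t => c + c * t * (c * t)) (2 * c ^ 2 * t) t := by
    refine (((d1 t).mul (d1 t)).const_add c).congr_deriv ?_
    ring
  have d3 (t : ℝ) : HasDerivAt (fun t => 2 * c ^ 2 * t + (c + c * t * (c * t)) * (c * t))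
      (2 * c ^ 2 + (2 * c ^ 2 * t * (c * t) + (c + c * t * (c * t)) * c)) t := by
    refine (((hasDerivAt_id t).const_mul (2 * c ^ 2)).add ((d2 t).mul (d1 t))).congr_deriv ?_
    ring
  rw [iteratedDeriv_succ', iteratedDeriv_succ', iteratedDeriv_succ', iteratedDeriv_one, h1,
    hp _ _ d1, hp _ _ d2, hp _ _ d3]
  simp
  ring

section Moments

variable {Ω : Type*} [MeasurableSpace Ω] {P : Measure Ω} {B : ℝ≥0 → Ω → ℝ}
  {f g : unitInterval → ℝ} {Y Z : Ω → ℝ}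

lemma IsWiener.memLp_four (hB : IsPreBrownianReal B P) (hf : IsWiener P B f Y) : MemLp Y 4 P := by
  have h := memLp_id_gaussianReal' (μ := 0) (v := (∫ u, f u ^ 2).toNNReal) 4 (by simp)
  rw [← (hf.hasLaw hB).map_eq] at h
  exact h.comp_of_map (hf.hasLaw hB).aemeasurable

lemma IsWiener.integrable_pow_four (hB : IsPreBrownianReal B P) (hf : IsWiener P B f Y) :
    Integrable (fun ω => Y ω ^ 4) P := by
  have h := (hf.memLp_four hB).integrable_norm_pow (p := 4) (by norm_num)
  refine h.congr (Eventually.of_forall fun ω => ?_)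
  simp only [Real.norm_eq_abs]
  exact Even.pow_abs (by decide) _

lemma IsWiener.integral_pow_four (hB : IsPreBrownianReal B P) (hf : IsWiener P B f Y) :
    ∫ ω, Y ω ^ 4 ∂P = 3 * (∫ u, f u ^ 2) ^ 2 := by
  have h := (hf.hasLaw hB).integral_comp (f := fun x => x ^ 4)
    (by fun_prop : Measurable fun x : ℝ => x ^ 4).aestronglyMeasurable
  simp only [Function.comp_def] at h
  rw [h, integral_pow_four_gaussianReal,
    Real.coe_toNNReal _ (integral_nonneg fun _ => sq_nonneg _)]

lemma IsWiener.integrable_sq_mul_sq (hB : IsPreBrownianReal B P) (hf : IsWiener P B f Y)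
    (hg : IsWiener P B g Z) : Integrable (fun ω => Y ω ^ 2 * Z ω ^ 2) P := by
  refine ((hf.integrable_pow_four hB).add (hg.integrable_pow_four hB)).mono'
    ((hf.memLp.1.pow 2).mul (hg.memLp.1.pow 2)) (Eventually.of_forall fun ω => ?_)
  rw [Real.norm_of_nonneg (by positivity), Pi.add_apply]
  nlinarith [sq_nonneg (Y ω ^ 2 - Z ω ^ 2), sq_nonneg (Y ω ^ 2 + Z ω ^ 2)]

/-- The squares of the integrals of orthogonal functions are uncorrelated. -/
lemma IsWiener.integral_sq_mul_sq (hB : IsPreBrownianReal B P) (hf : IsWiener P B f Y)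
    (hg : IsWiener P B g Z) (hfg : ∫ u, f u * g u = 0) :
    ∫ ω, Y ω ^ 2 * Z ω ^ 2 ∂P = (∫ u, f u ^ 2) * ∫ u, g u ^ 2 := by
  have h1 := (hf.add hB hg).integral_pow_four hB
  have h2 := (hf.sub hB hg).integral_pow_four hB
  have i1 := hf.memLp_fun.integrable_sq
  have i2 := hg.memLp_fun.integrable_sq
  have i3 : Integrable (fun u => f u * g u) volume := hf.memLp_fun.integrable_mul hg.memLp_fun
  have i4 : Integrable (fun u => f u ^ 2 + g u ^ 2) volume := i1.add i2
  have e1 : ∫ u, (f + g) u ^ 2 = (∫ u, f u ^ 2) + ∫ u, g u ^ 2 := by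
    have : ∀ u, (f + g) u ^ 2 = f u ^ 2 + g u ^ 2 + 2 * (f u * g u) := fun u => by
      rw [Pi.add_apply]; ring
    simp_rw [this]
    rw [integral_add i4 (i3.const_mul 2), integral_add i1 i2, integral_const_mul, hfg]
    ring
  have e2 : ∫ u, (f - g) u ^ 2 = (∫ u, f u ^ 2) + ∫ u, g u ^ 2 := by
    have : ∀ u, (f - g) u ^ 2 = f u ^ 2 + g u ^ 2 - 2 * (f u * g u) := fun u => by
      rw [Pi.sub_apply]; ring
    simp_rw [this]
    rw [integral_sub i4 (i3.const_mul 2), integral_add i1 i2, integral_const_mul, hfg]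
    ring
  have h3 := hf.integral_pow_four hB
  have h4 := hg.integral_pow_four hB
  -- Polarization avoids any joint law: `Y + Z` and `Y - Z` both have variance `a + b` by
  -- orthogonality, so this reads `6(a+b)² = 6a² + 12 E[Y²Z²] + 6b²`.
  have e3 : (∫ ω, (Y + Z) ω ^ 4 ∂P) + ∫ ω, (Y - Z) ω ^ 4 ∂P =
      2 * (∫ ω, Y ω ^ 4 ∂P) + 12 * (∫ ω, Y ω ^ 2 * Z ω ^ 2 ∂P) + 2 * ∫ ω, Z ω ^ 4 ∂P := by
    rw [← integral_add ((hf.add hB hg).integrable_pow_four hB)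
      ((hf.sub hB hg).integrable_pow_four hB), ← integral_const_mul, ← integral_const_mul,
      ← integral_const_mul, ← integral_add, ← integral_add]
    · refine integral_congr_ae (Eventually.of_forall fun ω => ?_)
      simp only [Pi.add_apply, Pi.sub_apply]
      ring
    · exact ((hf.integrable_pow_four hB).const_mul 2).add
        ((hf.integrable_sq_mul_sq hB hg).const_mul 12)
    · exact (hg.integrable_pow_four hB).const_mul 2
    · exact (hf.integrable_pow_four hB).const_mul 2
    · exact (hf.integrable_sq_mul_sq hB hg).const_mul 12
  rw [h1, h2, e1, e2, h3, h4] at e3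
  linarith

end Moments

/-! ### The integrated squared volatility -/

/-- `∫₀ᵗ σ²`. -/
def energy (σ : unitInterval → ℝ) (t : unitInterval) : ℝ := ∫ u in Set.Iic t, σ u ^ 2

section Energy

variable {σ : unitInterval → ℝ}

lemma IsVolatility.exists_bound (hσ : IsVolatility σ) : ∃ C, 0 ≤ C ∧ ∀ t, σ t ≤ C := by
  obtain ⟨C, hC⟩ := hσ.bddAbove
  have h (t) : σ t ≤ C := hC ⟨t, rfl⟩
  exact ⟨C, (hσ.nonneg 0).trans (h 0), h⟩

lemma IsVolatility.memLp (hσ : IsVolatility σ) (p : ℝ≥0∞) : MemLp σ p volume := by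
  obtain ⟨C, -, hC⟩ := hσ.exists_bound
  refine MemLp.of_bound hσ.measurable.aestronglyMeasurable C (Eventually.of_forall fun t => ?_)
  rw [Real.norm_of_nonneg (hσ.nonneg t)]
  exact hC t

lemma IsVolatility.memLp_indicator (hσ : IsVolatility σ) (t : unitInterval) (p : ℝ≥0∞) :
    MemLp ((Set.Iic t).indicator σ) p volume :=
  (hσ.memLp p).indicator measurableSet_Iic

lemma IsVolatility.integrable_sq (hσ : IsVolatility σ) : Integrable (fun u => σ u ^ 2) volume :=
  (hσ.memLp 2).integrable_sq

lemma integral_indicator_sq (s : Set unitInterval) (hs : MeasurableSet s) :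
    ∫ u, s.indicator σ u ^ 2 = ∫ u in s, σ u ^ 2 := by
  rw [← integral_indicator hs]
  refine integral_congr_ae (Eventually.of_forall fun u => ?_)
  by_cases h : u ∈ s <;> simp [h]

lemma indicator_Iic_sub_indicator_Iic (σ : unitInterval → ℝ) {a b : unitInterval} (h : a ≤ b) :
    (Set.Iic b).indicator σ - (Set.Iic a).indicator σ = (Set.Ioc a b).indicator σ := by
  ext u
  by_cases h1 : u ≤ a
  · simp [h1, h1.trans h, not_lt.2 h1]
  · by_cases h2 : u ≤ b <;> simp [h1, h2, not_le.1 h1]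

lemma IsVolatility.setIntegral_Ioc (hσ : IsVolatility σ) {a b : unitInterval} (h : a ≤ b) :
    ∫ u in Set.Ioc a b, σ u ^ 2 = energy σ b - energy σ a := by
  have := setIntegral_union (μ := volume) (f := fun u => σ u ^ 2) (s := Set.Iic a)
    (t := Set.Ioc a b) (Set.disjoint_left.2 fun x hx hx' => not_lt.2 hx hx'.1) measurableSet_Ioc
    hσ.integrable_sq.integrableOn hσ.integrable_sq.integrableOn
  rw [Set.Iic_union_Ioc_eq_Iic h] at this
  rw [energy, energy, this]
  ring

lemma energy_zero (σ : unitInterval → ℝ) : energy σ 0 = 0 := by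
  have h : (Set.Iic (0 : unitInterval)) = {0} := by
    ext u
    exact ⟨fun hu => le_antisymm hu u.2.1, fun hu => le_of_eq hu⟩
  rw [energy, h]
  exact setIntegral_measure_zero _ (by simp)

lemma energy_one (σ : unitInterval → ℝ) : energy σ 1 = ∫ u, σ u ^ 2 := by
  have h : Set.Iic (1 : unitInterval) = Set.univ := by
    ext u
    exact iff_of_true u.2.2 trivial
  rw [energy, h, setIntegral_univ]

/-- Boundedness of `σ` makes the energy Lipschitz; all dyadic rates below come from this. -/
lemma IsVolatility.energy_sub_le (hσ : IsVolatility σ) {C : ℝ} (hC : ∀ t, σ t ≤ C)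
    {a b : unitInterval} (h : a ≤ b) : energy σ b - energy σ a ≤ C ^ 2 * (b - a) := by
  rw [← hσ.setIntegral_Ioc h]
  calc ∫ u in Set.Ioc a b, σ u ^ 2 ≤ ∫ u in Set.Ioc a b, C ^ 2 := by
        refine setIntegral_mono hσ.integrable_sq.integrableOn (integrable_const _).integrableOn
          fun u => ?_
        exact pow_le_pow_left₀ (hσ.nonneg u) (hC u) 2
    _ = C ^ 2 * (b - a) := by
        rw [setIntegral_const, Measure.real, unitInterval.volume_Ioc,
          ENNReal.toReal_ofReal (by simpa using h), smul_eq_mul, mul_comm]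

lemma monotone_energy (hσ : IsVolatility σ) : Monotone (energy σ) := fun a b h => by
  have := hσ.setIntegral_Ioc h
  have h2 : 0 ≤ ∫ u in Set.Ioc a b, σ u ^ 2 := integral_nonneg fun _ => sq_nonneg _
  linarith

end Energy

/-! ### A continuous version of the integral process -/

lemma gridPoint_two_mul (n k : ℕ) : gridPoint (2 ^ (n + 1)) (2 * k) = gridPoint (2 ^ n) k := by
  ext
  rw [coe_gridPoint, coe_gridPoint, pow_succ']
  push_cast
  rw [mul_div_mul_left _ _ two_ne_zero]

/-- The largest dyadic point of level `n` below `t`. -/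
def dyadicFloor (n : ℕ) (t : unitInterval) : unitInterval :=
  gridPoint (2 ^ n) ⌊(2 : ℝ) ^ n * t⌋₊

lemma floor_two_pow_mul_le (n : ℕ) (t : unitInterval) : ⌊(2 : ℝ) ^ n * t⌋₊ ≤ 2 ^ n := by
  refine Nat.floor_le_of_le ?_
  push_cast
  exact mul_le_of_le_one_right (by positivity) t.2.2

lemma coe_dyadicFloor (n : ℕ) (t : unitInterval) :
    (dyadicFloor n t : ℝ) = ⌊(2 : ℝ) ^ n * t⌋₊ / 2 ^ n := by
  rw [dyadicFloor, coe_gridPoint_of_le (floor_two_pow_mul_le n t)]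
  push_cast
  rfl

lemma dyadicFloor_le (n : ℕ) (t : unitInterval) : dyadicFloor n t ≤ t := by
  have h2 : (0 : ℝ) < 2 ^ n := by positivity
  rw [← Subtype.coe_le_coe, coe_dyadicFloor, div_le_iff₀ h2, mul_comm (t : ℝ)]
  exact Nat.floor_le (mul_nonneg h2.le t.2.1)

lemma le_dyadicFloor_add (n : ℕ) (t : unitInterval) :
    (t : ℝ) ≤ dyadicFloor n t + (1 / 2) ^ n := by
  rw [coe_dyadicFloor, one_div, inv_pow, ← one_div, ← add_div,
    le_div_iff₀ (by positivity), mul_comm]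
  exact (Nat.lt_floor_add_one _).le

/-! ### Deterministic chaining along dyadic points. -/

section Chaining

variable {F : unitInterval → ℝ} {b : ℕ → ℝ}

/-- Refining the grid sends index `k` to `2k` or `2k + 1`, so the floor moves by at most one cell of
the finer level. -/
lemma dist_dyadicFloor_succ_le (hb0 : ∀ n, 0 ≤ b n)
    (hb : ∀ n k, k < 2 ^ n → |F (gridPoint (2 ^ n) (k + 1)) - F (gridPoint (2 ^ n) k)| ≤ b n)
    (n : ℕ) (t : unitInterval) :
    dist (F (dyadicFloor n t)) (F (dyadicFloor (n + 1) t)) ≤ b (n + 1) := by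
  have ht : (0 : ℝ) ≤ t := t.2.1
  set k := ⌊(2 : ℝ) ^ n * t⌋₊ with hk
  set j := ⌊(2 : ℝ) ^ (n + 1) * t⌋₊ with hj
  have e1 : dyadicFloor n t = gridPoint (2 ^ (n + 1)) (2 * k) := by
    rw [gridPoint_two_mul]; rfl
  have e2 : dyadicFloor (n + 1) t = gridPoint (2 ^ (n + 1)) j := rfl
  have hk1 : (k : ℝ) ≤ 2 ^ n * t := Nat.floor_le (by positivity)
  have hk2 : 2 ^ n * (t : ℝ) < k + 1 := Nat.lt_floor_add_one _
  have hj1 : 2 * k ≤ j := by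
    rw [hj]
    refine Nat.le_floor ?_
    push_cast
    rw [pow_succ']
    linarith
  have hj2 : j < 2 * k + 2 := by
    rw [hj, Nat.floor_lt (by positivity)]
    push_cast
    rw [pow_succ']
    linarith
  have hj3 : j ≤ 2 ^ (n + 1) := floor_two_pow_mul_le (n + 1) t
  rw [e1, e2, dist_comm, Real.dist_eq]
  obtain h | h : j = 2 * k ∨ j = 2 * k + 1 := by omega
  · rw [h, sub_self, abs_zero]
    exact hb0 _
  · rw [h]
    exact hb (n + 1) (2 * k) (by omega)

/-- Points closer than one cell width have equal or adjacent floors. -/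
lemma abs_dyadicFloor_sub_le (hb0 : ∀ n, 0 ≤ b n)
    (hb : ∀ n k, k < 2 ^ n → |F (gridPoint (2 ^ n) (k + 1)) - F (gridPoint (2 ^ n) k)| ≤ b n)
    (n : ℕ) {s t : unitInterval} (h : dist s t < (1 / 2) ^ n) :
    |F (dyadicFloor n s) - F (dyadicFloor n t)| ≤ b n := by
  wlog hst : s ≤ t generalizing s t
  · rw [abs_sub_comm]
    exact this (by rwa [dist_comm]) (le_of_not_ge hst)
  have hst' : (s : ℝ) ≤ t := hst
  have hs : (0 : ℝ) ≤ s := s.2.1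
  have ht : (0 : ℝ) ≤ t := t.2.1
  rw [dist_comm, Subtype.dist_eq, Real.dist_eq, abs_of_nonneg (by linarith), one_div, inv_pow,
    ← one_div, lt_div_iff₀ (by positivity)] at h
  set k := ⌊(2 : ℝ) ^ n * s⌋₊ with hk
  set j := ⌊(2 : ℝ) ^ n * t⌋₊ with hj
  have e1 : dyadicFloor n s = gridPoint (2 ^ n) k := rfl
  have e2 : dyadicFloor n t = gridPoint (2 ^ n) j := rfl
  have hk2 : 2 ^ n * (s : ℝ) < k + 1 := Nat.lt_floor_add_one _
  have hj1 : k ≤ j := Nat.floor_mono (by gcongr)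
  have hj2 : j < k + 2 := by
    rw [hj, Nat.floor_lt (by positivity)]
    push_cast
    linarith
  have hj3 : j ≤ 2 ^ n := floor_two_pow_mul_le n t
  rw [e1, e2, abs_sub_comm]
  obtain h | h : j = k ∨ j = k + 1 := by omega
  · rw [h, sub_self, abs_zero]
    exact hb0 _
  · rw [h]
    exact hb n k (by omega)

/-- If the dyadic increments of `F` are bounded by a summable sequence, then the dyadic
approximations of `F` converge uniformly to a continuous function. -/
lemma exists_continuous_tendsto_dyadicFloor (hb0 : ∀ n, 0 ≤ b n) (hbs : Summable b)
    (hb : ∀ n k, k < 2 ^ n → |F (gridPoint (2 ^ n) (k + 1)) - F (gridPoint (2 ^ n) k)| ≤ b n) :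
    ∃ G : unitInterval → ℝ, Continuous G ∧
      ∀ t, Tendsto (fun n => F (dyadicFloor n t)) atTop (𝓝 (G t)) := by
  have hbs' : Summable fun n => b (n + 1) := (summable_nat_add_iff 1).2 hbs
  have hlim (t : unitInterval) : ∃ l, Tendsto (fun n => F (dyadicFloor n t)) atTop (𝓝 l) :=
    cauchySeq_tendsto_of_complete
      (cauchySeq_of_dist_le_of_summable _ (fun n => dist_dyadicFloor_succ_le hb0 hb n t) hbs')
  choose G hG using hlim
  refine ⟨G, Metric.continuous_iff.2 fun t η hη => ?_, hG⟩
  have hr (n : ℕ) (t : unitInterval) : dist (F (dyadicFloor n t)) (G t) ≤ ∑' m, b (n + m + 1) :=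
    dist_le_tsum_of_dist_le_of_tendsto _ (fun n => dist_dyadicFloor_succ_le hb0 hb n t) hbs'
      (hG t) n
  have h1 : Tendsto (fun n => ∑' m, b (n + m + 1)) atTop (𝓝 0) := by
    refine (tendsto_sum_nat_add fun n => b (n + 1)).congr fun n => ?_
    simp only [add_comm]
  obtain ⟨n, hn1, hn2⟩ := ((h1.eventually_lt_const (by positivity : (0 : ℝ) < η / 3)).and
    (hbs.tendsto_atTop_zero.eventually_lt_const (by positivity : (0 : ℝ) < η / 3))).exists
  -- The bound `η` splits into two tails of the chain, at `s` and at `t`, and one increment of level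
  -- `n`.
  refine ⟨(1 / 2) ^ n, by positivity, fun s hs => ?_⟩
  have h2 := abs_dyadicFloor_sub_le hb0 hb n hs
  have h3 := hr n s
  have h4 := hr n t
  rw [← Real.dist_eq] at h2
  rw [dist_comm] at h3
  calc dist (G s) (G t) ≤ dist (G s) (F (dyadicFloor n s)) +
        dist (F (dyadicFloor n s)) (F (dyadicFloor n t)) + dist (F (dyadicFloor n t)) (G t) :=
        dist_triangle4 _ _ _ _
    _ < η := by linarith

end Chaining

section ContinuousVersion

variable (σ : unitInterval → ℝ)

/-- The integral of `σ` up to time `t` as a functional of the path. -/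
def rawIntegral (t : unitInterval) (w : ℝ≥0 → ℝ) : ℝ := wienerIntegral ((Set.Iic t).indicator σ) w

/-- The sum of the fourth powers of the dyadic increments of level `n`, suitably weighted. -/
def quarticSum (n : ℕ) (w : ℝ≥0 → ℝ) : ℝ :=
  (∑ k ∈ Finset.range (2 ^ n), (rawIntegral σ (gridPoint (2 ^ n) (k + 1)) w -
    rawIntegral σ (gridPoint (2 ^ n) k) w) ^ 4) / ((9 / 10) ^ n) ^ 3

/-- The paths along which the dyadic increments of the integral process are summably small. -/
def regularPaths : Set (ℝ≥0 → ℝ) := {w | ∑' n, ENNReal.ofReal (quarticSum σ n w) < ∞}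

open scoped Classical in
/-- A continuous version of the integral process, as a functional of the path. -/
def contIntegral (t : unitInterval) (w : ℝ≥0 → ℝ) : ℝ :=
  if w ∈ regularPaths σ then limsup (fun n => rawIntegral σ (dyadicFloor n t) w) atTop else 0

lemma measurable_rawIntegral (t : unitInterval) : Measurable (rawIntegral σ t) :=
  measurable_wienerIntegral _

lemma measurable_quarticSum (n : ℕ) : Measurable (quarticSum σ n) := by
  refine Measurable.div_const (Finset.measurable_fun_sum _ fun k _ => ?_) _
  exact ((measurable_rawIntegral σ _).sub (measurable_rawIntegral σ _)).pow_const 4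

lemma measurableSet_regularPaths : MeasurableSet (regularPaths σ) :=
  measurableSet_lt (Measurable.tsum fun n => (measurable_quarticSum σ n).ennreal_ofReal)
    measurable_const

lemma measurable_contIntegral (t : unitInterval) : Measurable (contIntegral σ t) :=
  Measurable.ite (measurableSet_regularPaths σ)
    (Measurable.limsup fun _ => measurable_rawIntegral σ _) measurable_const

lemma quarticSum_nonneg (n : ℕ) (w : ℝ≥0 → ℝ) : 0 ≤ quarticSum σ n w :=
  div_nonneg (Finset.sum_nonneg fun _ _ => Even.pow_nonneg (by decide) _) (by positivity)

/-- With `a = (9/10)^n`, summable `quarticSum` forces summable dyadic increments. Any base `r < 1`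
with `r³ > 1/2` would do; the second condition makes the expectations of `quarticSum` summable. -/
lemma abs_le_add_pow_four_div {a x : ℝ} (ha : 0 < a) : |x| ≤ a + x ^ 4 / a ^ 3 := by
  have h4 : x ^ 4 = |x| ^ 4 := (Even.pow_abs (by decide) x).symm
  rw [h4]
  have hx := abs_nonneg x
  rcases le_total |x| a with h | h
  · have : 0 ≤ |x| ^ 4 / a ^ 3 := by positivity
    linarith
  · have : |x| ≤ |x| ^ 4 / a ^ 3 := by
      rw [le_div_iff₀ (by positivity), pow_succ' |x| 3]
      gcongr
    linarith

lemma exists_continuous_of_mem_regularPaths {w : ℝ≥0 → ℝ} (hw : w ∈ regularPaths σ) :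
    ∃ G : unitInterval → ℝ, Continuous G ∧
      ∀ t, Tendsto (fun n => rawIntegral σ (dyadicFloor n t) w) atTop (𝓝 (G t)) := by
  have hs : Summable fun n => quarticSum σ n w := by
    refine (ENNReal.summable_toReal (ne_of_lt hw)).congr fun n => ?_
    exact ENNReal.toReal_ofReal (quarticSum_nonneg σ n w)
  refine exists_continuous_tendsto_dyadicFloor (F := fun t => rawIntegral σ t w)
    (b := fun n => (9 / 10) ^ n + quarticSum σ n w)
    (fun n => add_nonneg (by positivity) (quarticSum_nonneg σ n w))
    ((summable_geometric_of_lt_one (by norm_num) (by norm_num)).add hs) fun n k hk => ?_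
  refine (abs_le_add_pow_four_div (a := (9 / 10) ^ n) (by positivity)).trans ?_
  rw [quarticSum]
  gcongr
  exact Finset.single_le_sum (f := fun k => (rawIntegral σ (gridPoint (2 ^ n) (k + 1)) w -
    rawIntegral σ (gridPoint (2 ^ n) k) w) ^ 4) (fun _ _ => Even.pow_nonneg (by decide) _)
    (Finset.mem_range.2 hk)

/-- Continuity holds along every path, as the model demands, because irregular paths are sent to the
zero function. -/
lemma continuous_contIntegral (w : ℝ≥0 → ℝ) : Continuous fun t => contIntegral σ t w := by
  by_cases hw : w ∈ regularPaths σ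
  · obtain ⟨G, hG, hlim⟩ := exists_continuous_of_mem_regularPaths σ hw
    convert hG with t
    rw [contIntegral, if_pos hw, (hlim t).limsup_eq]
  · simp only [contIntegral, if_neg hw]
    exact continuous_const

lemma tendsto_contIntegral {w : ℝ≥0 → ℝ} (hw : w ∈ regularPaths σ) (t : unitInterval) :
    Tendsto (fun n => rawIntegral σ (dyadicFloor n t) w) atTop (𝓝 (contIntegral σ t w)) := by
  obtain ⟨G, hG, hlim⟩ := exists_continuous_of_mem_regularPaths σ hw
  rw [contIntegral, if_pos hw, (hlim t).limsup_eq]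
  exact hlim t

end ContinuousVersion

/-- By Tonelli the sum has finite expectation. This plays the role of Borel–Cantelli, for chaining
and for quadratic variation. -/
lemma ae_tsum_ofReal_lt_top {α : Type*} [MeasurableSpace α] {μ : Measure α} {F : ℕ → α → ℝ}
    {c : ℕ → ℝ} (hF : ∀ n, Integrable (F n) μ) (hF0 : ∀ n x, 0 ≤ F n x)
    (hc : ∀ n, ∫ x, F n x ∂μ ≤ c n) (hc0 : ∀ n, 0 ≤ c n) (hcs : Summable c) :
    ∀ᵐ x ∂μ, ∑' n, ENNReal.ofReal (F n x) < ∞ := by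
  have hlt : ∫⁻ x, ∑' n, ENNReal.ofReal (F n x) ∂μ < ∞ := by
    rw [lintegral_tsum fun n => (hF n).1.aemeasurable.ennreal_ofReal]
    calc ∑' n, ∫⁻ x, ENNReal.ofReal (F n x) ∂μ
        ≤ ∑' n : ℕ, ENNReal.ofReal (c n) := by
          refine ENNReal.tsum_le_tsum fun n => ?_
          rw [← ofReal_integral_eq_lintegral_ofReal (hF n) (Eventually.of_forall (hF0 n))]
          exact ENNReal.ofReal_le_ofReal (hc n)
      _ < ∞ := by
          rw [← ENNReal.ofReal_tsum_of_nonneg hc0 hcs]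
          exact ENNReal.ofReal_lt_top
  exact ae_lt_top' (AEMeasurable.tsum fun n => (hF n).1.aemeasurable.ennreal_ofReal) hlt.ne

/-! ### The continuous version along Brownian paths. -/

section Law

variable {Ω : Type*} [MeasurableSpace Ω] {P : Measure Ω} {B : ℝ≥0 → Ω → ℝ}
  {σ : unitInterval → ℝ}

lemma isWiener_rawIntegral (hB : IsPreBrownianReal B P) (hσ : IsVolatility σ) (t : unitInterval) :
    IsWiener P B ((Set.Iic t).indicator σ) (fun ω => rawIntegral σ t (fun s => B s ω)) :=
  (isItoIntegral_wienerIntegral hB (hσ.memLp_indicator t 2)).isWiener (hσ.memLp_indicator t 2)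

lemma IsWiener.increment {I : unitInterval → Ω → ℝ} (hB : IsPreBrownianReal B P)
    (hI : ∀ t, IsWiener P B ((Set.Iic t).indicator σ) (I t)) {a b : unitInterval} (h : a ≤ b) :
    IsWiener P B ((Set.Ioc a b).indicator σ) (fun ω => I b ω - I a ω) := by
  rw [← indicator_Iic_sub_indicator_Iic σ h]
  exact (hI b).sub hB (hI a)

/-- Each of the `2^n` increments has fourth moment at most `3 (C² 2^{-n})²`; after weighting, the
expectations decay like `((1/2) / (9/10)³)^n`, with ratio below 1. -/
lemma ae_mem_regularPaths (hB : IsPreBrownianReal B P) (hσ : IsVolatility σ) :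
    ∀ᵐ ω ∂P, (fun s => B s ω) ∈ regularPaths σ := by
  obtain ⟨C, hC0, hC⟩ := hσ.exists_bound
  have hinc (n k : ℕ) := IsWiener.increment hB (isWiener_rawIntegral hB hσ)
    (monotone_gridPoint (2 ^ n) (Nat.le_succ k))
  have hint (n : ℕ) : Integrable (fun ω => quarticSum σ n (fun s => B s ω)) P :=
    (integrable_finsetSum _ fun k _ => (hinc n k).integrable_pow_four hB).div_const _
  have hbound (n : ℕ) : ∫ ω, quarticSum σ n (fun s => B s ω) ∂P ≤
      3 * C ^ 4 * ((1 / 2) / (9 / 10) ^ 3) ^ n := by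
    simp only [quarticSum]
    rw [integral_div, integral_finsetSum _ fun k _ => (hinc n k).integrable_pow_four hB]
    have hk (k : ℕ) (hk : k ∈ Finset.range (2 ^ n)) :
        ∫ ω, (rawIntegral σ (gridPoint (2 ^ n) (k + 1)) (fun s => B s ω) -
          rawIntegral σ (gridPoint (2 ^ n) k) (fun s => B s ω)) ^ 4 ∂P ≤
        3 * (C ^ 2 * (1 / 2) ^ n) ^ 2 := by
      have hk' := Finset.mem_range.1 hk
      have hle := monotone_gridPoint (2 ^ n) (Nat.le_succ k)
      rw [(hinc n k).integral_pow_four hB, integral_indicator_sq _ measurableSet_Ioc]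
      have h0 : 0 ≤ ∫ u in Set.Ioc (gridPoint (2 ^ n) k) (gridPoint (2 ^ n) k.succ), σ u ^ 2 :=
        integral_nonneg fun _ => sq_nonneg _
      gcongr
      rw [hσ.setIntegral_Ioc hle]
      refine (hσ.energy_sub_le hC hle).trans (le_of_eq ?_)
      rw [coe_gridPoint_of_le hk', coe_gridPoint_of_le hk'.le]
      push_cast
      rw [← sub_div, add_sub_cancel_left, one_div, one_div, inv_pow]
    calc (∑ k ∈ Finset.range (2 ^ n), ∫ ω,
          (rawIntegral σ (gridPoint (2 ^ n) (k + 1)) (fun s => B s ω) -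
          rawIntegral σ (gridPoint (2 ^ n) k) (fun s => B s ω)) ^ 4 ∂P) / ((9 / 10) ^ n) ^ 3
        ≤ (∑ k ∈ Finset.range (2 ^ n), 3 * (C ^ 2 * (1 / 2) ^ n) ^ 2) / ((9 / 10) ^ n) ^ 3 := by
          gcongr with k hk'
          exact hk k hk'
      _ = 3 * C ^ 4 * ((1 / 2) / (9 / 10) ^ 3) ^ n := by
          have h2 : (2 : ℝ) ^ n * ((1 / 2) ^ n) = 1 := by rw [← mul_pow]; norm_num
          rw [Finset.sum_const, Finset.card_range, nsmul_eq_mul,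
            div_pow (1 / 2) ((9 / 10 : ℝ) ^ 3) n, ← pow_mul _ 3 n,
            mul_comm 3 n, pow_mul, ← mul_div_assoc]
          push_cast
          congr 1
          generalize (1 / 2 : ℝ) ^ n = x at *
          generalize (2 : ℝ) ^ n = y at *
          linear_combination (3 * C ^ 4 * x) * h2
  exact ae_tsum_ofReal_lt_top hint (fun n ω => quarticSum_nonneg σ n _) hbound
    (fun _ => by positivity)
    ((summable_geometric_of_lt_one (by norm_num) (by norm_num)).mul_left _)

lemma tendsto_eLpNorm_two_zero {α : Type*} [MeasurableSpace α] {μ : Measure α} {F : ℕ → α → ℝ}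
    (hF : ∀ n, MemLp (F n) 2 μ) (h : Tendsto (fun n => ∫ x, F n x ^ 2 ∂μ) atTop (𝓝 0)) :
    Tendsto (fun n => eLpNorm (F n) 2 μ) atTop (𝓝 0) := by
  rw [← ENNReal.tendsto_toReal_iff (fun n => (hF n).2.ne) ENNReal.zero_ne_top]
  have h2 := (Real.continuous_sqrt.tendsto 0).comp h
  simp only [Function.comp_def, ← toReal_eLpNorm_two_sq (hF _), Real.sqrt_zero,
    Real.sqrt_sq ENNReal.toReal_nonneg] at h2
  simpa using h2

/-- The integrals up to `dyadicFloor n t` tend in `L²` to the integral up to `t`, as the energy is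
Lipschitz, and almost surely to the continuous version. Limits in measure are unique. -/
lemma contIntegral_ae_eq (hB : IsPreBrownianReal B P) (hσ : IsVolatility σ) (t : unitInterval) :
    (fun ω => rawIntegral σ t (fun s => B s ω)) =ᵐ[P]
      fun ω => contIntegral σ t (fun s => B s ω) := by
  have : IsProbabilityMeasure P := hB.isGaussianProcess.isProbabilityMeasure
  obtain ⟨C, hC0, hC⟩ := hσ.exists_bound
  have hw := isWiener_rawIntegral hB hσ
  have hinc (n : ℕ) := IsWiener.increment hB hw (dyadicFloor_le n t)
  have h1 : Tendsto (fun n => ∫ ω, (rawIntegral σ t (fun s => B s ω) -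
      rawIntegral σ (dyadicFloor n t) (fun s => B s ω)) ^ 2 ∂P) atTop (𝓝 0) := by
    refine squeeze_zero (fun n => integral_nonneg fun _ => sq_nonneg _)
      (g := fun n => C ^ 2 * (1 / 2) ^ n) (fun n => ?_) ?_
    · rw [(hinc n).integral_sq hB, integral_indicator_sq _ measurableSet_Ioc,
        hσ.setIntegral_Ioc (dyadicFloor_le n t)]
      refine (hσ.energy_sub_le hC (dyadicFloor_le n t)).trans ?_
      gcongr
      linarith [le_dyadicFloor_add n t]
    · simpa using (tendsto_pow_atTop_nhds_zero_of_lt_one (r := (1 / 2 : ℝ)) (by norm_num)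
        (by norm_num)).const_mul (C ^ 2)
  have h2 := tendsto_eLpNorm_two_zero (fun n => (hinc n).memLp) h1
  refine tendstoInMeasure_ae_unique
    (tendstoInMeasure_of_tendsto_eLpNorm (p := 2) two_ne_zero
      (fun n => (hw (dyadicFloor n t)).memLp.1)
      (hw t).memLp.1 (h2.congr fun n => eLpNorm_sub_comm _ _ _ _))
    (tendstoInMeasure_of_tendsto_ae (fun n => (hw (dyadicFloor n t)).memLp.1) ?_)
  filter_upwards [ae_mem_regularPaths hB hσ] with ω hω
  exact tendsto_contIntegral σ hω t

lemma isItoIntegral_contIntegral (hB : IsPreBrownianReal B P) (hσ : IsVolatility σ)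
    (t : unitInterval) : IsItoIntegral P B ((Set.Iic t).indicator σ)
      (fun ω => contIntegral σ t (fun s => B s ω)) := by
  obtain ⟨h1, s, h2, h3⟩ := isItoIntegral_wienerIntegral hB (hσ.memLp_indicator t 2)
  have h := contIntegral_ae_eq hB hσ t
  refine ⟨h1.ae_eq h, s, h2, h3.congr fun m => eLpNorm_congr_ae ?_⟩
  filter_upwards [h] with ω hω
  rw [← hω]
  rfl

end Law

/-! ### Quadratic variation -/

/-- The sum of the squared increments of `F` over the dyadic partition of `[0, t]` of level `m`. -/
def qvSum (F : unitInterval → ℝ) (t : unitInterval) (m : ℕ) : ℝ :=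
  ∑ k ∈ Finset.range (2 ^ m),
    (F (t * gridPoint (2 ^ m) (k + 1)) - F (t * gridPoint (2 ^ m) k)) ^ 2

/-- The quadratic variation of `F` on `[0, t]` along dyadic partitions. -/
def quadVar (t : unitInterval) (F : unitInterval → ℝ) : ℝ := limsup (fun m => qvSum F t m) atTop

lemma measurable_quadVar (t : unitInterval) : Measurable (quadVar t) :=
  Measurable.limsup fun _ => Finset.measurable_fun_sum _ fun _ _ => by fun_prop

section

variable {Ω : Type*} [MeasurableSpace Ω] {P : Measure Ω} {B : ℝ≥0 → Ω → ℝ}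
  {σ : unitInterval → ℝ}

/-- The centred squares of orthogonal integrals are uncorrelated, each with variance `3v² - v² =
2v²`, so only the diagonal survives. -/
lemma integral_sum_sq_sub_sq {f : ℕ → unitInterval → ℝ} {Y : ℕ → Ω → ℝ}
    (hB : IsPreBrownianReal B P) (hY : ∀ k, IsWiener P B (f k) (Y k))
    (hf : ∀ k l, k ≠ l → ∫ u, f k u * f l u = 0) (n : ℕ) :
    Integrable (fun ω => (∑ k ∈ Finset.range n, (Y k ω ^ 2 - ∫ u, f k u ^ 2)) ^ 2) P ∧
    ∫ ω, (∑ k ∈ Finset.range n, (Y k ω ^ 2 - ∫ u, f k u ^ 2)) ^ 2 ∂P =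
      ∑ k ∈ Finset.range n, 2 * (∫ u, f k u ^ 2) ^ 2 := by
  have : IsProbabilityMeasure P := hB.isGaussianProcess.isProbabilityMeasure
  set v : ℕ → ℝ := fun k => ∫ u, f k u ^ 2 with hv
  have hsq (k : ℕ) : Integrable (fun ω => Y k ω ^ 2) P := (hY k).memLp.integrable_sq
  have hE (k : ℕ) : ∫ ω, Y k ω ^ 2 ∂P = v k := (hY k).integral_sq hB
  have hexp (k l : ℕ) (ω : Ω) : (Y k ω ^ 2 - v k) * (Y l ω ^ 2 - v l) =
      Y k ω ^ 2 * Y l ω ^ 2 - v k * Y l ω ^ 2 - (v l * Y k ω ^ 2 - v k * v l) := by ring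
  have i1 (k l : ℕ) : Integrable (fun ω => Y k ω ^ 2 * Y l ω ^ 2 - v k * Y l ω ^ 2) P :=
    ((hY k).integrable_sq_mul_sq hB (hY l)).sub ((hsq l).const_mul _)
  have i2 (k l : ℕ) : Integrable (fun ω => v l * Y k ω ^ 2 - v k * v l) P :=
    ((hsq k).const_mul _).sub (integrable_const _)
  have i3 (k l : ℕ) : Integrable (fun ω => (Y k ω ^ 2 - v k) * (Y l ω ^ 2 - v l)) P := by
    simp only [hexp]
    exact (i1 k l).sub (i2 k l)
  have hcov (k l : ℕ) : ∫ ω, (Y k ω ^ 2 - v k) * (Y l ω ^ 2 - v l) ∂P =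
      if k = l then 2 * v k ^ 2 else 0 := by
    simp only [hexp]
    rw [integral_sub (i1 k l) (i2 k l),
      integral_sub ((hY k).integrable_sq_mul_sq hB (hY l)) ((hsq l).const_mul _),
      integral_sub ((hsq k).const_mul _) (integrable_const _), integral_const_mul,
      integral_const_mul, integral_const, hE, hE]
    simp only [probReal_univ, one_smul]
    split_ifs with h
    · subst h
      have h4 := (hY k).integral_pow_four hB
      have : ∫ ω, Y k ω ^ 2 * Y k ω ^ 2 ∂P = 3 * v k ^ 2 := by
        rw [← h4]
        exact integral_congr_ae (Eventually.of_forall fun ω => by ring)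
      rw [this]
      ring
    · rw [(hY k).integral_sq_mul_sq hB (hY l) (hf k l h)]
      simp only [hv]
      ring
  have hprod (ω : Ω) : (∑ k ∈ Finset.range n, (Y k ω ^ 2 - v k)) ^ 2 =
      ∑ k ∈ Finset.range n, ∑ l ∈ Finset.range n, (Y k ω ^ 2 - v k) * (Y l ω ^ 2 - v l) := by
    rw [sq, Finset.sum_mul_sum]
  change Integrable (fun ω => (∑ k ∈ Finset.range n, (Y k ω ^ 2 - v k)) ^ 2) P ∧
    ∫ ω, (∑ k ∈ Finset.range n, (Y k ω ^ 2 - v k)) ^ 2 ∂P = ∑ k ∈ Finset.range n, 2 * v k ^ 2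
  simp only [hprod]
  refine ⟨integrable_finsetSum _ fun k _ => integrable_finsetSum _ fun l _ => i3 k l, ?_⟩
  rw [integral_finsetSum _ fun k _ => integrable_finsetSum _ fun l _ => i3 k l]
  refine Finset.sum_congr rfl fun k hk => ?_
  rw [integral_finsetSum _ fun l _ => i3 k l]
  simp only [hcov, Finset.sum_ite_eq, hk, if_true]

/-- The mean squared error is `2 ∑ v_k² ≤ 2 (max v_k) V(t) ≤ 2 C² 2^{-m} V(t)`. It is summable in
`m`, so convergence is almost sure along the full dyadic sequence. -/
lemma ae_tendsto_qvSum {I : unitInterval → Ω → ℝ} (hB : IsPreBrownianReal B P)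
    (hσ : IsVolatility σ) (hI : ∀ t, IsWiener P B ((Set.Iic t).indicator σ) (I t))
    (t : unitInterval) :
    ∀ᵐ ω ∂P, Tendsto (fun m => qvSum (fun s => I s ω) t m) atTop (𝓝 (energy σ t)) := by
  obtain ⟨C, hC0, hC⟩ := hσ.exists_bound
  have hmono (m : ℕ) : Monotone fun k => t * gridPoint (2 ^ m) k := fun k l h => by
    rw [← Subtype.coe_le_coe]
    exact mul_le_mul_of_nonneg_left (monotone_gridPoint (2 ^ m) h) t.2.1
  have hinc (m k : ℕ) := IsWiener.increment hB hI (hmono m (Nat.le_succ k))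
  have horth (m k l : ℕ) (hkl : k ≠ l) :
      ∫ u, (Set.Ioc (t * gridPoint (2 ^ m) k) (t * gridPoint (2 ^ m) k.succ)).indicator σ u *
        (Set.Ioc (t * gridPoint (2 ^ m) l) (t * gridPoint (2 ^ m) l.succ)).indicator σ u = 0 := by
    have hd := (hmono m).pairwise_disjoint_on_Ioc_succ hkl
    rw [← integral_zero unitInterval ℝ]
    refine integral_congr_ae (Eventually.of_forall fun u => ?_)
    by_cases hu : u ∈ Set.Ioc (t * gridPoint (2 ^ m) k) (t * gridPoint (2 ^ m) k.succ)
    · have hu' : u ∉ Set.Ioc (t * gridPoint (2 ^ m) l) (t * gridPoint (2 ^ m) l.succ) :=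
        Set.disjoint_left.1 hd hu
      simp [Set.indicator_of_notMem hu']
    · simp [Set.indicator_of_notMem hu]
  have hvar (m k : ℕ) : ∫ u, (Set.Ioc (t * gridPoint (2 ^ m) k)
      (t * gridPoint (2 ^ m) k.succ)).indicator σ u ^ 2 =
      energy σ (t * gridPoint (2 ^ m) (k + 1)) - energy σ (t * gridPoint (2 ^ m) k) := by
    rw [integral_indicator_sq _ measurableSet_Ioc, hσ.setIntegral_Ioc (hmono m (Nat.le_succ k))]
  have htel (m : ℕ) : ∑ k ∈ Finset.range (2 ^ m), (energy σ (t * gridPoint (2 ^ m) (k + 1)) -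
      energy σ (t * gridPoint (2 ^ m) k)) = energy σ t := by
    have h0 : gridPoint (2 ^ m) 0 = 0 := by
      ext
      rw [coe_gridPoint_of_le (Nat.zero_le _)]
      simp
    have h1 : gridPoint (2 ^ m) (2 ^ m) = 1 := by
      ext
      rw [coe_gridPoint_of_le le_rfl, div_self (by positivity)]
      simp
    rw [Finset.sum_range_sub fun k => energy σ (t * gridPoint (2 ^ m) k), h0, h1, mul_zero,
      mul_one, energy_zero, sub_zero]
  have hsum (m : ℕ) (ω : Ω) : qvSum (fun s => I s ω) t m - energy σ t =
      ∑ k ∈ Finset.range (2 ^ m), ((I (t * gridPoint (2 ^ m) k.succ) ω -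
        I (t * gridPoint (2 ^ m) k) ω) ^ 2 - ∫ u, (Set.Ioc (t * gridPoint (2 ^ m) k)
          (t * gridPoint (2 ^ m) k.succ)).indicator σ u ^ 2) := by
    rw [Finset.sum_sub_distrib, qvSum]
    simp only [hvar, htel]
  have hbound (m : ℕ) : ∫ ω, (qvSum (fun s => I s ω) t m - energy σ t) ^ 2 ∂P ≤
      2 * C ^ 2 * energy σ t * (1 / 2) ^ m := by
    simp only [hsum]
    rw [(integral_sum_sq_sub_sq hB (hinc m) (horth m) (2 ^ m)).2]
    simp only [hvar]
    calc ∑ k ∈ Finset.range (2 ^ m), 2 * (energy σ (t * gridPoint (2 ^ m) (k + 1)) -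
          energy σ (t * gridPoint (2 ^ m) k)) ^ 2
        ≤ ∑ k ∈ Finset.range (2 ^ m), 2 * (C ^ 2 * (1 / 2) ^ m) *
          (energy σ (t * gridPoint (2 ^ m) (k + 1)) - energy σ (t * gridPoint (2 ^ m) k)) := by
          refine Finset.sum_le_sum fun k hk => ?_
          have hk' := Finset.mem_range.1 hk
          have h0 := sub_nonneg.2 (monotone_energy hσ (hmono m (Nat.le_succ k)))
          have h1 : energy σ (t * gridPoint (2 ^ m) (k + 1)) - energy σ (t * gridPoint (2 ^ m) k) ≤
              C ^ 2 * (1 / 2) ^ m := by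
            refine (hσ.energy_sub_le hC (hmono m (Nat.le_succ k))).trans ?_
            have h2 : ((t * gridPoint (2 ^ m) k.succ : unitInterval) : ℝ) -
                (t * gridPoint (2 ^ m) k : unitInterval) = t * (1 / 2) ^ m := by
              rw [Set.Icc.coe_mul, Set.Icc.coe_mul, ← mul_sub, Nat.succ_eq_add_one,
                coe_gridPoint_of_le hk', coe_gridPoint_of_le hk'.le]
              push_cast
              rw [← sub_div, add_sub_cancel_left, one_div, one_div, inv_pow]
            rw [h2]
            gcongr
            exact mul_le_of_le_one_left (by positivity) t.2.2
          rw [sq, ← mul_assoc]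
          exact mul_le_mul_of_nonneg_right (by linarith) h0
      _ = 2 * C ^ 2 * energy σ t * (1 / 2) ^ m := by
          rw [← Finset.mul_sum, htel]
          ring
  have hV : 0 ≤ energy σ t := integral_nonneg fun _ => sq_nonneg _
  have hae := ae_tsum_ofReal_lt_top (μ := P)
    (F := fun m ω => (qvSum (fun s => I s ω) t m - energy σ t) ^ 2)
    (fun m => by
      simp only [hsum]
      exact (integral_sum_sq_sub_sq hB (hinc m) (horth m) (2 ^ m)).1)
    (fun _ _ => sq_nonneg _) hbound (fun _ => by positivity)
    ((summable_geometric_of_lt_one (by norm_num) (by norm_num)).mul_left _)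
  filter_upwards [hae] with ω hω
  have hs : Summable fun m => (qvSum (fun s => I s ω) t m - energy σ t) ^ 2 := by
    refine (ENNReal.summable_toReal hω.ne).congr fun n => ?_
    exact ENNReal.toReal_ofReal (sq_nonneg _)
  have h1 := (Real.continuous_sqrt.tendsto 0).comp hs.tendsto_atTop_zero
  simp only [Function.comp_def, Real.sqrt_sq_eq_abs, Real.sqrt_zero] at h1
  rw [tendsto_iff_norm_sub_tendsto_zero]
  exact h1

/-- Quadratic variation of a scaled integral process. -/
lemma ae_quadVar_eq {I R : unitInterval → Ω → ℝ} {g : Ω → ℝ} (hB : IsPreBrownianReal B P)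
    (hσ : IsVolatility σ) (hI : ∀ t, IsWiener P B ((Set.Iic t).indicator σ) (I t))
    (hR : ∀ t, ∀ᵐ ω ∂P, R t ω = g ω * I t ω) (t : unitInterval) :
    ∀ᵐ ω ∂P, quadVar t (fun s => R s ω) = g ω ^ 2 * energy σ t := by
  -- The relation has a null set depending on time; the partitions use only countably many times.
  have h1 : ∀ᵐ ω ∂P, ∀ m k : ℕ, R (t * gridPoint (2 ^ m) k) ω =
      g ω * I (t * gridPoint (2 ^ m) k) ω := by
    rw [ae_all_iff]
    intro m
    rw [ae_all_iff]
    exact fun k => hR _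
  filter_upwards [h1, ae_tendsto_qvSum hB hσ hI t] with ω h1 h2
  refine ((h2.const_mul (g ω ^ 2)).congr fun m => ?_).limsup_eq
  rw [qvSum, qvSum, Finset.mul_sum]
  refine Finset.sum_congr rfl fun k _ => ?_
  rw [h1, h1]
  ring

end

/-! ### The companion operator of an autoregression -/

/-- The companion operator `(v₀, …, v_q) ↦ (∑ φ_{j+1} v_j, v₀, …, v_{q-1})`. -/
def companion (q : ℕ) (φ : ℕ → ℝ) : (Fin (q + 1) → ℂ) →L[ℂ] (Fin (q + 1) → ℂ) :=
  LinearMap.toContinuousLinearMap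
    { toFun v := Fin.cons (∑ j : Fin (q + 1), (φ (j + 1) : ℂ) * v j) fun k : Fin q => v k.castSucc
      map_add' v w := by
        ext k
        refine Fin.cases ?_ (fun k => ?_) k
        · simp [mul_add, Finset.sum_add_distrib]
        · simp
      map_smul' c v := by
        ext k
        refine Fin.cases ?_ (fun k => ?_) k
        · simp only [Fin.cons_zero, Pi.smul_apply, smul_eq_mul, RingHom.id_apply, Finset.mul_sum]
          exact Finset.sum_congr rfl fun _ _ => by ring
        · simp }

section Companion

variable {q : ℕ} {φ : ℕ → ℝ}

lemma companion_zero (v : Fin (q + 1) → ℂ) :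
    companion q φ v 0 = ∑ j : Fin (q + 1), (φ (j + 1) : ℂ) * v j := rfl

lemma companion_succ (v : Fin (q + 1) → ℂ) (k : Fin q) :
    companion q φ v k.succ = v k.castSucc := rfl

lemma sum_fin_eq_sum_Icc {M : Type*} [AddCommMonoid M] (q : ℕ) (a : ℕ → M) :
    ∑ j : Fin (q + 1), a (j + 1) = ∑ j ∈ Finset.Icc 1 (q + 1), a j := by
  rw [Fin.sum_univ_eq_sum_range fun j => a (j + 1), Finset.range_eq_Ico,
    Finset.sum_Ico_add' a 0 (q + 1) 1]
  rfl

/-- The shift rows force `v_k = z^{-k} v_0`, and the first row then says that `z⁻¹` is a root of the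
autoregressive polynomial. Causality forbids `|z⁻¹| ≤ 1`. -/
lemma IsCausal.norm_lt_one_of_eigenvector (hφ : IsCausal (q + 1) φ) {z : ℂ}
    {v : Fin (q + 1) → ℂ} (hv : v ≠ 0) (h : companion q φ v = z • v) : ‖z‖ < 1 := by
  by_contra! hz
  have hz0 : z ≠ 0 := norm_pos_iff.1 (one_pos.trans_le hz)
  have h1 (k : ℕ) (hk : k < q + 1) : v ⟨k, hk⟩ = z⁻¹ ^ k * v 0 := by
    induction k with
    | zero => simp
    | succ k ih =>
      have h2 := congrFun h (Fin.succ ⟨k, by omega⟩)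
      rw [companion_succ, Pi.smul_apply, smul_eq_mul] at h2
      have h3 : v ⟨k + 1, hk⟩ = z⁻¹ * v ⟨k, by omega⟩ := by
        rw [eq_inv_mul_iff_mul_eq₀ hz0]
        exact h2.symm
      rw [h3, ih, pow_succ']
      ring
  have hv0 : v 0 ≠ 0 := fun h0 => hv <| by
    ext k
    rw [show k = ⟨k.1, k.2⟩ from rfl, h1, h0, mul_zero, Pi.zero_apply]
  have h2 := congrFun h 0
  rw [companion_zero, Pi.smul_apply, smul_eq_mul] at h2
  have h3 : ∑ j : Fin (q + 1), (φ (j + 1) : ℂ) * z⁻¹ ^ ((j : ℕ) + 1) = 1 := by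
    have h4 : (∑ j : Fin (q + 1), (φ (j + 1) : ℂ) * z⁻¹ ^ ((j : ℕ) + 1)) * (z * v 0) = z * v 0 := by
      conv_rhs => rw [← h2]
      rw [Finset.sum_mul]
      refine Finset.sum_congr rfl fun j _ => ?_
      rw [show v j = z⁻¹ ^ (j : ℕ) * v 0 from h1 j j.2, pow_succ]
      field_simp
    exact mul_right_cancel₀ (mul_ne_zero hz0 hv0) (h4.trans (one_mul _).symm)
  rw [sum_fin_eq_sum_Icc q fun j => (φ j : ℂ) * z⁻¹ ^ j] at h3
  refine hφ.2.2 z⁻¹ ?_ (by rw [h3, sub_self])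
  rw [norm_inv]
  exact inv_le_one_of_one_le₀ hz

lemma IsCausal.norm_lt_one_of_mem_spectrum (hφ : IsCausal (q + 1) φ) {z : ℂ}
    (hz : z ∈ spectrum ℂ (companion q φ)) : ‖z‖ < 1 := by
  rw [spectrum.mem_iff, ContinuousLinearMap.isUnit_iff_bijective] at hz
  set T := algebraMap ℂ ((Fin (q + 1) → ℂ) →L[ℂ] (Fin (q + 1) → ℂ)) z - companion q φ with hT
  have hinj : ¬ Function.Injective T.toLinearMap := fun hi =>
    hz ⟨hi, (LinearMap.injective_iff_surjective (f := T.toLinearMap)).1 hi⟩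
  rw [← LinearMap.ker_eq_bot, LinearMap.ker_eq_bot'] at hinj
  push Not at hinj
  obtain ⟨v, hv, hv0⟩ := hinj
  refine hφ.norm_lt_one_of_eigenvector hv0 ?_
  have : z • v - companion q φ v = 0 := by
    simpa [hT, Algebra.algebraMap_eq_smul_one] using hv
  exact (sub_eq_zero.1 this).symm

/-- Gelfand's formula: the spectral radius lies below some `r < 1`, so `‖A^n‖ ≤ r^n` eventually. -/
lemma IsCausal.summable_norm_pow (hφ : IsCausal (q + 1) φ) :
    Summable fun n => ‖companion q φ ^ n‖ := by
  set a := companion q φ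
  have h1 : spectralRadius ℂ a < (1 : ℝ≥0) :=
    spectrum.spectralRadius_lt_of_forall_lt a fun z hz => hφ.norm_lt_one_of_mem_spectrum hz
  obtain ⟨r, hr1, hr2⟩ := ENNReal.lt_iff_exists_nnreal_btwn.1 h1
  have h2 := (spectrum.pow_nnnorm_pow_one_div_tendsto_nhds_spectralRadius a).eventually_lt_const hr1
  refine Summable.of_norm_bounded_eventually_nat (g := fun n => (r : ℝ) ^ n)
    (summable_geometric_of_lt_one r.2 (by exact_mod_cast hr2)) ?_
  filter_upwards [h2, eventually_gt_atTop 0] with n hn hn0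
  rw [norm_norm]
  have h3 : (‖a ^ n‖₊ : ℝ≥0∞) ≤ (r : ℝ≥0∞) ^ n := by
    have h4 := ENNReal.rpow_le_rpow hn.le (Nat.cast_nonneg n : (0 : ℝ) ≤ n)
    rwa [← ENNReal.rpow_mul, one_div_mul_cancel (by exact_mod_cast hn0.ne'), ENNReal.rpow_one,
      ENNReal.rpow_natCast] at h4
  exact_mod_cast h3

end Companion

/-! ### Tight families and homogeneous solutions -/

/-- Uniform tightness of a family of random variables. -/
def IsTightFamily {Ω : Type*} [MeasurableSpace Ω] (P : Measure Ω) (u : ℤ → Ω → ℝ) : Prop :=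
  ∀ δ : ℝ≥0∞, δ ≠ 0 → ∃ M : ℝ, ∀ i, P {ω | M < |u i ω|} ≤ δ

section Tight

variable {Ω : Type*} [MeasurableSpace Ω] {P : Measure Ω} {u v : ℤ → Ω → ℝ}

lemma isTightFamily_of_map_eq [IsFiniteMeasure P] (hu : ∀ i, AEMeasurable (u i) P)
    (h : ∀ i, P.map (u i) = P.map (u 0)) : IsTightFamily P u := by
  intro δ hδ
  have hs (M : ℝ) : MeasurableSet {x : ℝ | M < |x|} :=
    measurableSet_lt measurable_const (by fun_prop)
  have h1 : Tendsto (fun n : ℕ => (P.map (u 0)) {x : ℝ | (n : ℝ) < |x|}) atTop (𝓝 0) := by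
    have h2 : ⋂ n : ℕ, {x : ℝ | (n : ℝ) < |x|} = ∅ := by
      ext x
      simp only [Set.mem_iInter, Set.mem_ofPred_eq, Set.mem_empty_iff_false, iff_false, not_forall,
        not_lt]
      exact exists_nat_ge _
    rw [← measure_empty (μ := P.map (u 0)), ← h2]
    refine tendsto_measure_iInter_atTop (fun n => (hs n).nullMeasurableSet) ?_
      ⟨0, measure_ne_top _ _⟩
    intro m n hmn x hx
    exact (Nat.cast_le.2 hmn : (m : ℝ) ≤ n).trans_lt hx
  obtain ⟨n, hn⟩ := (h1.eventually_lt_const (pos_iff_ne_zero.2 hδ)).exists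
  refine ⟨n, fun i => ?_⟩
  rw [← h i, Measure.map_apply_of_aemeasurable (hu i) (hs n)] at hn
  exact hn.le

/-- Unlike equality of laws, tightness survives differences with no knowledge of joint laws. This is
why it replaces stationarity in the uniqueness argument. -/
lemma IsTightFamily.sub (hu : IsTightFamily P u) (hv : IsTightFamily P v) :
    IsTightFamily P fun i ω => u i ω - v i ω := by
  intro δ hδ
  have hδ2 : δ / 2 ≠ 0 := (ENNReal.half_pos hδ).ne'
  obtain ⟨M, hM⟩ := hu _ hδ2
  obtain ⟨N, hN⟩ := hv _ hδ2
  refine ⟨M + N, fun i => ?_⟩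
  calc P {ω | M + N < |u i ω - v i ω|} ≤ P ({ω | M < |u i ω|} ∪ {ω | N < |v i ω|}) := by
        refine measure_mono fun ω hω => ?_
        by_contra hc
        simp only [Set.mem_union, Set.mem_ofPred_eq, not_or, not_lt] at hc hω
        linarith [abs_sub (u i ω) (v i ω)]
    _ ≤ P {ω | M < |u i ω|} + P {ω | N < |v i ω|} := measure_union_le _ _
    _ ≤ δ / 2 + δ / 2 := add_le_add (hM i) (hN i)
    _ = δ := ENNReal.add_halves δ

lemma IsTightFamily.congr_ae (hu : IsTightFamily P u) (h : ∀ i, u i =ᵐ[P] v i) :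
    IsTightFamily P v := by
  intro δ hδ
  obtain ⟨M, hM⟩ := hu δ hδ
  refine ⟨M, fun i => (measure_congr ?_).trans_le (hM i)⟩
  filter_upwards [h i] with ω hω
  exact congrArg (fun x => M < |x|) hω.symm

variable {q : ℕ} {φ : ℕ → ℝ}

/-- For the stacked vector `Y_i = (y_i, …, y_{i-q})` the recursion is `Y_i = A Y_{i-1}`, iterated
`n` times. -/
lemma norm_le_of_homogeneous {y : ℤ → ℝ}
    (hy : ∀ i, y i = ∑ j ∈ Finset.Icc 1 (q + 1), φ j * y (i - (j : ℤ))) (n : ℕ) (i : ℤ) :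
    |y i| ≤ ‖companion q φ ^ n‖ * ‖fun m : Fin (q + 1) => (y (i - n - (m : ℕ)) : ℂ)‖ := by
  set Y : ℤ → Fin (q + 1) → ℂ := fun i m => y (i - (m : ℕ)) with hY
  have hstep (i : ℤ) : Y i = companion q φ (Y (i - 1)) := by
    ext k
    refine Fin.cases ?_ (fun k => ?_) k
    · rw [companion_zero]
      simp only [hY, Fin.val_zero, Nat.cast_zero, sub_zero]
      rw [hy i, ← sum_fin_eq_sum_Icc q fun j => φ j * y (i - (j : ℤ))]
      push_cast
      simp only [sub_sub, add_comm (1 : ℤ)]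
    · rw [companion_succ]
      simp only [hY, Fin.val_succ, Fin.val_castSucc]
      push_cast
      rw [sub_sub, add_comm (1 : ℤ)]
  have hpow (n : ℕ) (i : ℤ) : Y i = (companion q φ ^ n) (Y (i - n)) := by
    induction n generalizing i with
    | zero => simp
    | succ n ih =>
      rw [hstep, ih (i - 1), pow_succ', sub_sub, add_comm (1 : ℤ)]
      push_cast
      rfl
  calc |y i| = ‖Y i 0‖ := by simp [hY]
    _ ≤ ‖Y i‖ := norm_le_pi_norm _ _
    _ = ‖(companion q φ ^ n) (Y (i - n))‖ := by rw [← hpow]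
    _ ≤ _ := ContinuousLinearMap.le_opNorm _ _

/-- A tight solution of a homogeneous causal autoregression vanishes. -/
lemma IsTightFamily.ae_eq_zero [IsFiniteMeasure P] (hφ : IsCausal (q + 1) φ)
    (hu : IsTightFamily P u)
    (h : ∀ i, ∀ᵐ ω ∂P, u i ω = ∑ j ∈ Finset.Icc 1 (q + 1), φ j * u (i - (j : ℤ)) ω) (i : ℤ) :
    ∀ᵐ ω ∂P, u i ω = 0 := by
  have key (η : ℝ) (hη : 0 < η) : P {ω | η ≤ |u i ω|} = 0 := by
    by_contra hne
    set S := {ω | η ≤ |u i ω|}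
    -- The stacked vector has `q + 1` coordinates, so the union bound will give `P S ≤ P S / 2`,
    -- which is absurd for `P S ≠ 0`.
    have hδ : P S / 2 / (q + 1 : ℕ) ≠ 0 := by
      simp [ENNReal.div_eq_zero_iff, hne]
    obtain ⟨M, hM⟩ := hu _ hδ
    have hlim : Tendsto (fun n => ‖companion q φ ^ n‖ * |M|) atTop (𝓝 0) := by
      simpa using hφ.summable_norm_pow.tendsto_atTop_zero.mul_const |M|
    obtain ⟨n, hn⟩ := (hlim.eventually_lt_const hη).exists
    have hsub : S ≤ᵐ[P] ⋃ m : Fin (q + 1), {ω | M < |u (i - n - (m : ℕ)) ω|} := by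
      filter_upwards [ae_all_iff.2 h] with ω hω hS
      by_contra hc
      have hc' : ¬ ω ∈ ⋃ m : Fin (q + 1), {ω | M < |u (i - n - (m : ℕ)) ω|} := hc
      simp only [Set.mem_iUnion, Set.mem_ofPred_eq, not_exists, not_lt] at hc'
      have h1 := norm_le_of_homogeneous (y := fun i => u i ω) hω n i
      have h2 : ‖fun m : Fin (q + 1) => (u (i - n - (m : ℕ)) ω : ℂ)‖ ≤ |M| := by
        refine (pi_norm_le_iff_of_nonneg (abs_nonneg M)).2 fun m => ?_
        rw [Complex.norm_real]
        exact (hc' m).trans (le_abs_self M)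
      have h3 : η ≤ |u i ω| := hS
      have h4 := mul_le_mul_of_nonneg_left h2 (norm_nonneg (companion q φ ^ n))
      linarith
    have h5 : P S ≤ P S / 2 := by
      calc P S ≤ P (⋃ m : Fin (q + 1), {ω | M < |u (i - n - (m : ℕ)) ω|}) := measure_mono_ae hsub
        _ ≤ ∑ m : Fin (q + 1), P {ω | M < |u (i - n - (m : ℕ)) ω|} := measure_iUnion_fintype_le _ _
        _ ≤ ∑ m : Fin (q + 1), P S / 2 / (q + 1 : ℕ) := Finset.sum_le_sum fun m _ => hM _
        _ = P S / 2 := by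
          rw [Finset.sum_const, Finset.card_univ, Fintype.card_fin, nsmul_eq_mul]
          exact ENNReal.mul_div_cancel (by simp) (by simp)
    exact (ENNReal.half_lt_self hne (measure_ne_top _ _)).not_ge h5
  have h1 (n : ℕ) : ∀ᵐ ω ∂P, |u i ω| < 1 / ((n : ℝ) + 1) := by
    rw [ae_iff]
    simp only [not_lt]
    exact key _ (by positivity)
  filter_upwards [ae_all_iff.2 h1] with ω hω
  by_contra hc
  obtain ⟨n, hn⟩ := exists_nat_one_div_lt (abs_pos.2 hc)
  exact (hω n).not_gt hn

end Tight

/-! ### The stationary solution of the autoregression -/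

/-- The coefficients of the moving average representation of the autoregression. -/
def arCoeff (q : ℕ) (φ : ℕ → ℝ) (k : ℕ) : ℝ := ((companion q φ ^ k) (Pi.single 0 1) 0).re

/-- The stationary solution of the autoregression as a functional of the noise. -/
def arSolution (q : ℕ) (φ : ℕ → ℝ) (e : ℤ → ℝ) (i : ℤ) : ℝ :=
  limsup (fun n => ∑ k ∈ Finset.range n, arCoeff q φ k * e (i - (k : ℤ))) atTop

/-! ### Moving averages of a fixed noise sequence. -/

section Deterministic

variable {q : ℕ} {φ : ℕ → ℝ} {e : ℤ → ℝ}

lemma measurable_arSolution (i : ℤ) : Measurable fun e : ℤ → ℝ => arSolution q φ e i :=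
  Measurable.limsup fun _ => by fun_prop

/-- Defined by a limsup, the functional commutes with shifts on all sequences, convergent or not;
stationarity will follow from this. -/
lemma arSolution_shift (h i : ℤ) : arSolution q φ (fun j => e (j + h)) i =
    arSolution q φ e (i + h) := by
  simp only [arSolution, add_sub_right_comm]

lemma norm_companion_pow_single_le (k : ℕ) :
    ‖(companion q φ ^ k) (Pi.single 0 1)‖ ≤ ‖companion q φ ^ k‖ := by
  have h : ‖(Pi.single 0 1 : Fin (q + 1) → ℂ)‖ ≤ 1 := by
    refine (pi_norm_le_iff_of_nonneg zero_le_one).2 fun m => ?_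
    by_cases hm : m = 0 <;> simp [hm]
  exact (companion q φ ^ k).unit_le_opNorm _ h

/-- The norm of the `k`-th power of the companion operator. -/
def arWeight (q : ℕ) (φ : ℕ → ℝ) (k : ℕ) : ℝ := ‖companion q φ ^ k‖

lemma arWeight_nonneg (k : ℕ) : 0 ≤ arWeight q φ k := norm_nonneg _

lemma IsCausal.summable_arWeight (hφ : IsCausal (q + 1) φ) : Summable (arWeight q φ) :=
  hφ.summable_norm_pow

lemma abs_arCoeff_le (k : ℕ) : |arCoeff q φ k| ≤ arWeight q φ k :=
  (Complex.abs_re_le_norm _).trans ((norm_le_pi_norm _ _).trans (norm_companion_pow_single_le k))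

lemma hasSum_arSolution {i : ℤ}
    (hs : Summable fun k : ℕ => arWeight q φ k * |e (i - (k : ℤ))|) :
    HasSum (fun k : ℕ => arCoeff q φ k * e (i - (k : ℤ))) (arSolution q φ e i) := by
  have h : Summable fun k : ℕ => arCoeff q φ k * e (i - (k : ℤ)) := by
    refine Summable.of_norm_bounded hs fun k => ?_
    rw [norm_mul, Real.norm_eq_abs, Real.norm_eq_abs]
    exact mul_le_mul_of_nonneg_right (abs_arCoeff_le k) (abs_nonneg _)
  convert h.hasSum
  exact h.hasSum.tendsto_sum_nat.limsup_eq

/-- The vector series `X_i = ∑ e_{i-k} A^k v` satisfies `X_i = e_i v + A X_{i-1}`. As `v` is the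
first unit vector and `A` shifts coordinates, coordinate `m` of `X_i` is coordinate `0` of
`X_{i-m}`, and row `0` is the autoregression. -/
lemma arSolution_eq
    (hs : ∀ i, Summable fun k : ℕ => arWeight q φ k * |e (i - (k : ℤ))|) (i : ℤ) :
    arSolution q φ e i =
      ∑ j ∈ Finset.Icc 1 (q + 1), φ j * arSolution q φ e (i - (j : ℤ)) + e i := by
  set A := companion q φ with hA
  set v : Fin (q + 1) → ℂ := Pi.single 0 1 with hv
  have hsum (i : ℤ) : Summable fun k : ℕ => (e (i - (k : ℤ)) : ℂ) • (A ^ k) v := by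
    refine Summable.of_norm_bounded (hs i) fun k => ?_
    rw [norm_smul, Complex.norm_real, mul_comm, Real.norm_eq_abs]
    exact mul_le_mul_of_nonneg_right (norm_companion_pow_single_le k) (abs_nonneg _)
  set X : ℤ → Fin (q + 1) → ℂ := fun i => ∑' k : ℕ, (e (i - (k : ℤ)) : ℂ) • (A ^ k) v with hX
  have hstep (i : ℤ) : X i = (e i : ℂ) • v + A (X (i - 1)) := by
    simp only [hX]
    rw [(hsum i).tsum_eq_zero_add, A.map_tsum (hsum (i - 1))]
    congr 1
    · simp
    · refine tsum_congr fun k => ?_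
      rw [map_smul, pow_succ', sub_sub, add_comm (1 : ℤ)]
      push_cast
      rfl
  have hcomp (m : ℕ) (hm : m < q + 1) (i : ℤ) : X i ⟨m, hm⟩ = X (i - m) 0 := by
    induction m generalizing i with
    | zero => simp
    | succ m ih =>
      have h1 := congrFun (hstep i) (Fin.succ ⟨m, by omega⟩)
      rw [Pi.add_apply, companion_succ] at h1
      have h2 : ((e i : ℂ) • v) (Fin.succ ⟨m, by omega⟩) = 0 := by simp [hv]
      rw [h2, zero_add] at h1
      refine h1.trans ((ih (by omega) (i - 1)).trans ?_)
      rw [sub_sub, add_comm (1 : ℤ)]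
      push_cast
      rfl
  have hre (i : ℤ) : arSolution q φ e i = (X i 0).re := by
    refine (hasSum_arSolution (hs i)).unique ?_
    have h := (hsum i).hasSum.mapL
      (Complex.reCLM.comp ((ContinuousLinearMap.proj (R := ℂ) (φ := fun _ : Fin (q + 1) => ℂ)
        0).restrictScalars ℝ))
    convert h using 2 with k
    · simp [arCoeff, hA, hv, mul_comm]
    · rfl
  have h1 := congrArg Complex.re (congrFun (hstep i) 0)
  rw [Pi.add_apply, companion_zero, Complex.add_re, Complex.re_sum] at h1
  rw [hre i, h1, add_comm, ← sum_fin_eq_sum_Icc q fun j => φ j * arSolution q φ e (i - (j : ℤ))]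
  congr 1
  · refine Finset.sum_congr rfl fun j _ => ?_
    rw [Complex.re_ofReal_mul, hre, show X (i - 1) j = X (i - 1 - (j : ℕ)) 0 from hcomp j j.2 _,
      sub_sub, add_comm (1 : ℤ)]
    push_cast
    rfl
  · simp [hv]

end Deterministic

/-! ### Moving averages of white noise. -/

section Noise

variable {Ω : Type*} [MeasurableSpace Ω] {P : Measure Ω}  {ε : ℤ → Ω → ℝ} {q : ℕ} {φ : ℕ → ℝ}

lemma IsWhiteNoise.memLp_two (hε : IsWhiteNoise P ε) (i : ℤ) : MemLp (ε i) 2 P :=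
  (hε.identDistrib i).symm.memLp_snd hε.memLp

lemma IsWhiteNoise.integrable [IsProbabilityMeasure P] (hε : IsWhiteNoise P ε) (i : ℤ) :
    Integrable (ε i) P :=
  (hε.memLp_two i).integrable one_le_two

lemma IsWhiteNoise.integral_abs (hε : IsWhiteNoise P ε) (i : ℤ) :
    ∫ ω, |ε i ω| ∂P = ∫ ω, |ε 0 ω| ∂P :=
  ((hε.identDistrib i).comp (u := fun x : ℝ => |x|) (by fun_prop)).integral_eq

lemma IsWhiteNoise.integral_eq_zero (hε : IsWhiteNoise P ε) (i : ℤ) : ∫ ω, ε i ω ∂P = 0 :=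
  (hε.identDistrib i).integral_eq.trans hε.mean_zero

lemma IsWhiteNoise.lintegral_tsum_ne_top [IsProbabilityMeasure P] (hε : IsWhiteNoise P ε)
    (hφ : IsCausal (q + 1) φ) (i : ℤ) :
    ∫⁻ ω, ∑' k : ℕ, ENNReal.ofReal (arWeight q φ k * |ε (i - (k : ℤ)) ω|) ∂P ≠ ∞ := by
  have hint (k : ℕ) : Integrable (fun ω => arWeight q φ k * |ε (i - (k : ℤ)) ω|) P :=
    (hε.integrable _).abs.const_mul _
  rw [lintegral_tsum fun k => (hint k).1.aemeasurable.ennreal_ofReal]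
  have h (k : ℕ) : ∫⁻ ω, ENNReal.ofReal (arWeight q φ k * |ε (i - (k : ℤ)) ω|) ∂P =
      ENNReal.ofReal (arWeight q φ k * ∫ ω, |ε 0 ω| ∂P) := by
    rw [← ofReal_integral_eq_lintegral_ofReal (hint k) 
      (Eventually.of_forall fun _ => mul_nonneg (arWeight_nonneg k) (abs_nonneg _)),
      integral_const_mul, hε.integral_abs]
  have hs : Summable fun k => arWeight q φ k * ∫ ω, |ε 0 ω| ∂P :=
    hφ.summable_arWeight.mul_right _
  have h0 (k : ℕ) : 0 ≤ arWeight q φ k * ∫ ω, |ε 0 ω| ∂P :=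
    mul_nonneg (arWeight_nonneg k) (integral_nonneg fun _ => abs_nonneg _)
  simp only [h]
  rw [← ENNReal.ofReal_tsum_of_nonneg h0 hs]
  exact ENNReal.ofReal_ne_top

lemma IsWhiteNoise.measurable_tsum (hε : IsWhiteNoise P ε) (i : ℤ) :
    Measurable fun ω => ∑' k : ℕ, ENNReal.ofReal (arWeight q φ k * |ε (i - (k : ℤ)) ω|) :=
  Measurable.tsum fun k => by
    have := hε.measurable (i - (k : ℤ))
    fun_prop

lemma IsWhiteNoise.ae_summable [IsProbabilityMeasure P] (hε : IsWhiteNoise P ε)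
    (hφ : IsCausal (q + 1) φ) :
    ∀ᵐ ω ∂P, ∀ i, Summable fun k : ℕ => arWeight q φ k * |ε (i - (k : ℤ)) ω| := by
  rw [ae_all_iff]
  intro i
  filter_upwards [ae_lt_top (hε.measurable_tsum i) (hε.lintegral_tsum_ne_top hφ i)] with ω hω
  refine (ENNReal.summable_toReal hω.ne).congr fun k => ?_
  exact ENNReal.toReal_ofReal (mul_nonneg (arWeight_nonneg _) (abs_nonneg _))

lemma IsWhiteNoise.measurable_arSolution (hε : IsWhiteNoise P ε) (i : ℤ) :
    Measurable fun ω => arSolution q φ (fun j => ε j ω) i :=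
  Measurable.comp (g := fun e => arSolution q φ e i) (f := fun ω j => ε j ω)
    (FunctionalSV.measurable_arSolution i) (measurable_pi_lambda _ hε.measurable)

lemma IsWhiteNoise.integrable_arSolution [IsProbabilityMeasure P] (hε : IsWhiteNoise P ε)
    (hφ : IsCausal (q + 1) φ) (i : ℤ) :
    Integrable (fun ω => arSolution q φ (fun j => ε j ω) i) P := by
  refine (integrable_toReal_of_lintegral_ne_top (hε.measurable_tsum i).aemeasurable
    (hε.lintegral_tsum_ne_top hφ i)).mono' (hε.measurable_arSolution i).aestronglyMeasurable ?_
  filter_upwards [hε.ae_summable hφ] with ω hω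
  have h1 := hasSum_arSolution (e := fun j => ε j ω) (hω i)
  have h0 (k : ℕ) : 0 ≤ arWeight q φ k * |ε (i - (k : ℤ)) ω| :=
    mul_nonneg (arWeight_nonneg k) (abs_nonneg _)
  rw [← ENNReal.ofReal_tsum_of_nonneg h0 (hω i), ENNReal.toReal_ofReal (tsum_nonneg h0),
    ← h1.tsum_eq]
  refine tsum_of_norm_bounded (hω i).hasSum fun k => ?_
  rw [norm_mul, Real.norm_eq_abs, Real.norm_eq_abs]
  exact mul_le_mul_of_nonneg_right (abs_arCoeff_le k) (abs_nonneg _)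

/-- Termwise integration of an absolutely convergent series. The zero mean is the normalization that
separates the level of `g` from that of `σ`. -/
lemma IsWhiteNoise.integral_arSolution [IsProbabilityMeasure P] (hε : IsWhiteNoise P ε)
    (hφ : IsCausal (q + 1) φ) (i : ℤ) :
    ∫ ω, arSolution q φ (fun j => ε j ω) i ∂P = 0 := by
  have hint (k : ℕ) : Integrable (fun ω => arCoeff q φ k * ε (i - (k : ℤ)) ω) P :=
    (hε.integrable _).const_mul _
  have hs : Summable fun k => arWeight q φ k * ∫ ω, |ε 0 ω| ∂P :=
    hφ.summable_arWeight.mul_right _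
  have hle (k : ℕ) : ∫ ω, ‖arCoeff q φ k * ε (i - (k : ℤ)) ω‖ ∂P ≤
      arWeight q φ k * ∫ ω, |ε 0 ω| ∂P := by
    simp only [norm_mul, Real.norm_eq_abs]
    rw [integral_const_mul, hε.integral_abs]
    exact mul_le_mul_of_nonneg_right (abs_arCoeff_le k) (integral_nonneg fun _ => abs_nonneg _)
  have h := hasSum_integral_of_summable_integral_norm hint
    (Summable.of_nonneg_of_le (fun k => integral_nonneg fun _ => norm_nonneg _) hle hs)
  have h0 (k : ℕ) : ∫ ω, arCoeff q φ k * ε (i - (k : ℤ)) ω ∂P = 0 := by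
    rw [integral_const_mul, hε.integral_eq_zero, mul_zero]
  simp only [h0] at h
  rw [← h.unique hasSum_zero]
  refine integral_congr_ae ?_
  filter_upwards [hε.ae_summable hφ] with ω hω
  exact (hasSum_arSolution (e := fun j => ε j ω) (hω i)).tsum_eq.symm

lemma IsWhiteNoise.map_shift [IsProbabilityMeasure P] (hε : IsWhiteNoise P ε) (h : ℤ) :
    P.map (fun ω i => ε (i + h) ω) = P.map (fun ω i => ε i ω) := by
  have h1 := (iIndepFun_iff_map_fun_eq_infinitePi_map hε.measurable).1 hε.iIndepFun
  have h2 := (iIndepFun_iff_map_fun_eq_infinitePi_map fun i => hε.measurable (i + h)).1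
    (hε.iIndepFun.precomp (add_left_injective h))
  rw [h1, h2]
  congr 1
  ext1 i
  rw [(hε.identDistrib _).map_eq, (hε.identDistrib i).map_eq]

lemma IsWhiteNoise.isTightFamily_arSolution [IsProbabilityMeasure P] (hε : IsWhiteNoise P ε) :
    IsTightFamily P fun i ω => arSolution q φ (fun j => ε j ω) i := by
  refine isTightFamily_of_map_eq (fun i => (hε.measurable_arSolution i).aemeasurable) fun i => ?_
  have hm : Measurable fun e : ℤ → ℝ => arSolution q φ e 0 := FunctionalSV.measurable_arSolution 0
  have hε1 : Measurable fun ω j => ε (j + i) ω := measurable_pi_lambda _ fun j => hε.measurable _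
  have hε0 : Measurable fun ω j => ε j ω := measurable_pi_lambda _ hε.measurable
  have h1 := congrArg (Measure.map fun e => arSolution q φ e 0) (hε.map_shift i)
  rw [Measure.map_map hm hε1, Measure.map_map hm hε0] at h1
  have h2 : (fun ω => arSolution q φ (fun j => ε j ω) i) =
      fun ω => arSolution q φ (fun j => ε (j + i) ω) 0 := by
    ext ω
    rw [arSolution_shift (e := fun j => ε j ω), zero_add]
  rw [h2]
  exact h1

end Noise

/-! ### Solutions of the model -/

section Brownian

variable {Ω : Type*} [MeasurableSpace Ω] {P : Measure Ω} {W : ℤ → ℝ≥0 → Ω → ℝ}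

lemma IsBrownianSequence.measurable_path (hW : IsBrownianSequence P W) (i : ℤ) :
    Measurable fun ω t => W i t ω := measurable_pi_lambda _ (hW.measurable i)

lemma IsBrownianSequence.map_path_eq [IsProbabilityMeasure P]
    (hW : IsBrownianSequence P W) (i j : ℤ) :
    P.map (fun ω t => W i t ω) = P.map (fun ω t => W j t ω) := by
  rw [map_eq_iff_forall_finset_map_restrict_eq (hW.measurable_path i).aemeasurable
    (hW.measurable_path j).aemeasurable]
  intro I
  rw [((hW.isBrownian i).hasLaw I).map_eq, ((hW.isBrownian j).hasLaw I).map_eq]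

lemma IsBrownianSequence.map_shift [IsProbabilityMeasure P] (hW : IsBrownianSequence P W) (h : ℤ) :
    P.map (fun ω i t => W (i + h) t ω) = P.map (fun ω i t => W i t ω) := by
  have h1 := (iIndepFun_iff_map_fun_eq_infinitePi_map hW.measurable_path).1 hW.iIndepFun
  have h2 := (iIndepFun_iff_map_fun_eq_infinitePi_map fun i => hW.measurable_path (i + h)).1
    (hW.iIndepFun.precomp (add_left_injective h))
  rw [h1, h2]
  congr 1
  ext1 i
  exact hW.map_path_eq _ _

variable {ε : ℤ → Ω → ℝ}

/-- Each factor has a shift-invariant law, and independence makes the joint law their product. -/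
lemma map_prodMk_shift [IsProbabilityMeasure P] (hW : IsBrownianSequence P W)
    (hε : IsWhiteNoise P ε)
    (hWε : IndepFun (fun ω i t => W i t ω) (fun ω i => ε i ω) P) (h : ℤ) :
    P.map (fun ω => ((fun i t => W (i + h) t ω, fun i => ε (i + h) ω) :
      (ℤ → ℝ≥0 → ℝ) × (ℤ → ℝ))) = P.map (fun ω => (fun i t => W i t ω, fun i => ε i ω)) := by
  have mW (h : ℤ) : Measurable fun ω i t => W (i + h) t ω :=
    measurable_pi_lambda _ fun i => hW.measurable_path (i + h)
  have mε (h : ℤ) : Measurable fun ω i => ε (i + h) ω :=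
    measurable_pi_lambda _ fun i => hε.measurable (i + h)
  have mW0 : Measurable fun ω i t => W i t ω := measurable_pi_lambda _ hW.measurable_path
  have mε0 : Measurable fun ω i => ε i ω := measurable_pi_lambda _ hε.measurable
  have hWε' : IndepFun (fun ω i t => W (i + h) t ω) (fun ω i => ε (i + h) ω) P :=
    hWε.comp (φ := fun (w : ℤ → ℝ≥0 → ℝ) i => w (i + h)) (ψ := fun (e : ℤ → ℝ) i => e (i + h))
      (by fun_prop) (by fun_prop)
  rw [(indepFun_iff_map_prod_eq_prod_map_map (mW h).aemeasurable (mε h).aemeasurable).1 hWε',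
    (indepFun_iff_map_prod_eq_prod_map_map mW0.aemeasurable mε0.aemeasurable).1 hWε,
    hW.map_shift, hε.map_shift]

end Brownian

section Model

variable {Ω : Type*} [MeasurableSpace Ω] {P : Measure Ω} {q : ℕ} {p : ℕ} {φ : ℕ → ℝ}
  {σ : unitInterval → ℝ} {ε : ℤ → Ω → ℝ} {W : ℤ → ℝ≥0 → Ω → ℝ} {g : ℤ → Ω → ℝ}
  {R : ℤ → unitInterval → Ω → ℝ}

/-- The stationary volatility sequence. -/
def volSolution (q : ℕ) (φ : ℕ → ℝ) (ε : ℤ → Ω → ℝ) (i : ℤ) (ω : Ω) : ℝ :=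
  Real.exp (arSolution q φ (fun j => ε j ω) i)

/-- The stationary sequence of return curves. -/
def curveSolution (q : ℕ) (φ : ℕ → ℝ) (σ : unitInterval → ℝ) (ε : ℤ → Ω → ℝ)
    (W : ℤ → ℝ≥0 → Ω → ℝ) (i : ℤ) (t : unitInterval) (ω : Ω) : ℝ :=
  volSolution q φ ε i ω * contIntegral σ t (fun s => W i s ω)

lemma isSolution_curveSolution [IsProbabilityMeasure P] (hφ : IsCausal (q + 1) φ)
    (hσ : IsVolatility σ) (hε : IsWhiteNoise P ε) (hW : IsBrownianSequence P W)
    (hWε : IndepFun (fun ω i t => W i t ω) (fun ω i => ε i ω) P) :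
    IsSolution P (q + 1) φ σ ε W (volSolution q φ ε) (curveSolution q φ σ ε W) where
  measurable_g i := (hε.measurable_arSolution i).exp
  pos_g i := Eventually.of_forall fun ω => Real.exp_pos _
  indep := hWε.comp (φ := id)
    (ψ := fun (e : ℤ → ℝ) i => Real.exp (arSolution q φ e i)) measurable_id
    (measurable_pi_lambda _ fun i => (measurable_arSolution i).exp)
  autoregression i := by
    filter_upwards [hε.ae_summable hφ] with ω hω
    simp only [volSolution, Real.log_exp]
    exact arSolution_eq (e := fun j => ε j ω) hω i
  measurable_R i t := (hε.measurable_arSolution i).exp.mul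
    ((measurable_contIntegral σ t).comp (hW.measurable_path i))
  continuous_R i ω := (continuous_contIntegral σ _).const_mul _
  integral_eq i t := ⟨_, isItoIntegral_contIntegral (hW.isBrownian i).toIsPreBrownianReal hσ t,
    Eventually.of_forall fun _ => rfl⟩

/-- The curves are `Φ(W, ε)` for one measurable `Φ` commuting with shifts, so they inherit the
stationarity of `(W, ε)`. -/
lemma isStrictlyStationary_curveSolution [IsProbabilityMeasure P]
    (hε : IsWhiteNoise P ε) (hW : IsBrownianSequence P W)
    (hWε : IndepFun (fun ω i t => W i t ω) (fun ω i => ε i ω) P) :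
    IsStrictlyStationary P (curveSolution q φ σ ε W) := by
  intro h
  set Φ : (ℤ → ℝ≥0 → ℝ) × (ℤ → ℝ) → ℤ → unitInterval → ℝ := fun z i t =>
    Real.exp (arSolution q φ z.2 i) * contIntegral σ t (z.1 i) with hΦ
  have mΦ : Measurable Φ := measurable_pi_lambda _ fun i => measurable_pi_lambda _ fun t =>
    ((measurable_arSolution i).comp measurable_snd).exp.mul
      ((measurable_contIntegral σ t).comp ((measurable_pi_apply i).comp measurable_fst))
  have mW (h : ℤ) : Measurable fun ω i t => W (i + h) t ω :=
    measurable_pi_lambda _ fun i => hW.measurable_path (i + h)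
  have mε (h : ℤ) : Measurable fun ω i => ε (i + h) ω :=
    measurable_pi_lambda _ fun i => hε.measurable (i + h)
  have mW0 : Measurable fun ω i t => W i t ω := measurable_pi_lambda _ hW.measurable_path
  have mε0 : Measurable fun ω i => ε i ω := measurable_pi_lambda _ hε.measurable
  have h1 := congrArg (Measure.map Φ) (map_prodMk_shift hW hε hWε h)
  rw [Measure.map_map mΦ ((mW h).prodMk (mε h)), Measure.map_map mΦ (mW0.prodMk mε0)] at h1
  have h2 : (fun ω i t => curveSolution q φ σ ε W (i + h) t ω) =
      Φ ∘ fun ω => (fun i t => W (i + h) t ω, fun i => ε (i + h) ω) := by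
    ext ω i t
    simp only [hΦ, Function.comp, curveSolution, volSolution]
    rw [arSolution_shift (e := fun j => ε j ω)]
  rw [h2, h1]
  rfl

/-- The Itô integral is almost surely unique, so every solution is expressed through the same
functional of `W_i`. -/
lemma IsSolution.ae_eq_mul_rawIntegral (h : IsSolution P p φ σ ε W g R) (hσ : IsVolatility σ)
    (hW : IsBrownianSequence P W) (i : ℤ) (t : unitInterval) :
    ∀ᵐ ω ∂P, R i t ω = g i ω * rawIntegral σ t (fun s => W i s ω) := by
  obtain ⟨Y, hY, hR⟩ := h.integral_eq i t
  have hB := (hW.isBrownian i).toIsPreBrownianReal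
  filter_upwards [hR, (hY.isWiener (hσ.memLp_indicator t 2)).ae_eq hB
    (isWiener_rawIntegral hB hσ t)] with ω h1 h2
  rw [h1, h2]

/-- A Gaussian law of positive variance has no atoms; this permits taking logarithms of `|R_i(1)|`.
-/
lemma ae_rawIntegral_ne_zero (hσ : IsVolatility σ) (hW : IsBrownianSequence P W)
    (hpos : 0 < energy σ 1) (i : ℤ) : ∀ᵐ ω ∂P, rawIntegral σ 1 (fun s => W i s ω) ≠ 0 := by
  have hB := (hW.isBrownian i).toIsPreBrownianReal
  have h := (isWiener_rawIntegral hB hσ 1).hasLaw hB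
  rw [integral_indicator_sq _ measurableSet_Iic] at h
  have hv : (∫ u in Set.Iic (1 : unitInterval), σ u ^ 2).toNNReal ≠ 0 :=
    (Real.toNNReal_pos.2 hpos).ne'
  have := nullSingletonClass_gaussianReal (μ := 0) hv
  have h1 : ∀ᵐ x ∂(gaussianReal 0 (∫ u in Set.Iic (1 : unitInterval), σ u ^ 2).toNNReal),
      x ≠ 0 := by
    rw [ae_iff]
    simp
  rw [← h.map_eq] at h1
  exact ae_of_ae_map h.aemeasurable h1

/-- The volatility sequence of a stationary solution with `σ ≠ 0` is the stationary solution of the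
autoregression. -/
theorem IsSolution.log_ae_eq [IsProbabilityMeasure P] (h : IsSolution P (q + 1) φ σ ε W g R)
    (hR : IsStrictlyStationary P R) (hφ : IsCausal (q + 1) φ) (hσ : IsVolatility σ)
    (hε : IsWhiteNoise P ε) (hW : IsBrownianSequence P W) (hpos : 0 < energy σ 1) (i : ℤ) :
    ∀ᵐ ω ∂P, Real.log (g i ω) = arSolution q φ (fun j => ε j ω) i := by
  have mlog : Measurable fun x : ℝ => Real.log |x| := by fun_prop
  have mR : Measurable fun ω i t => R i t ω :=
    measurable_pi_lambda _ fun i => measurable_pi_lambda _ (h.measurable_R i)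
  have mR' (k : ℤ) : Measurable fun ω i t => R (i + k) t ω :=
    measurable_pi_lambda _ fun i => measurable_pi_lambda _ (h.measurable_R _)
  have tR : IsTightFamily P fun i ω => Real.log |R i 1 ω| := by
    refine isTightFamily_of_map_eq (fun i => (mlog.comp (h.measurable_R i 1)).aemeasurable)
      fun i => ?_
    have me : Measurable fun F : ℤ → unitInterval → ℝ => Real.log |F 0 1| := by fun_prop
    have h1 := congrArg (Measure.map fun F : ℤ → unitInterval → ℝ => Real.log |F 0 1|) (hR i)
    rw [Measure.map_map me (mR' i), Measure.map_map me mR] at h1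
    simpa only [Function.comp_def, zero_add] using h1
  have mw : Measurable fun w => Real.log |rawIntegral σ 1 w| :=
    mlog.comp (measurable_rawIntegral σ 1)
  have tK : IsTightFamily P fun i ω => Real.log |rawIntegral σ 1 (fun s => W i s ω)| := by
    refine isTightFamily_of_map_eq (fun i => (mw.comp (hW.measurable_path i)).aemeasurable) fun i => ?_
    have h1 := congrArg (Measure.map fun w => Real.log |rawIntegral σ 1 w|) (hW.map_path_eq i 0)
    rwa [Measure.map_map mw (hW.measurable_path i), Measure.map_map mw (hW.measurable_path 0)] at h1
  -- Here `log g_i = log |R_i(1)| - log |I_i(1)|`; the first term has constant law by stationarity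
  -- of `R`, the second because the `W_i` share one law.
  have tg : IsTightFamily P fun i ω => Real.log (g i ω) := by
    refine (tR.sub tK).congr_ae fun i => ?_
    filter_upwards [h.ae_eq_mul_rawIntegral hσ hW i 1, h.pos_g i,
      ae_rawIntegral_ne_zero hσ hW hpos i] with ω h1 h2 h3
    rw [h1, abs_mul, abs_of_pos h2, Real.log_mul h2.ne' (abs_pos.2 h3).ne', add_sub_cancel_right]
  -- The noise cancels in the difference of two solutions, which leaves the homogeneous recursion.
  have h0 := (tg.sub (hε.isTightFamily_arSolution (q := q) (φ := φ))).ae_eq_zero hφ (fun i => by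
    filter_upwards [h.autoregression i, hε.ae_summable hφ] with ω h1 h2
    rw [h1, arSolution_eq (e := fun j => ε j ω) h2 i, add_sub_add_right_eq_sub,
      ← Finset.sum_sub_distrib]
    exact Finset.sum_congr rfl fun j _ => (mul_sub _ _ _).symm) i
  filter_upwards [h0] with ω hω
  exact sub_eq_zero.1 hω

lemma rawIntegral_ae_eq_zero (hσ : IsVolatility σ) (hW : IsBrownianSequence P W)
    (h0 : energy σ 1 = 0) (i : ℤ) (t : unitInterval) :
    ∀ᵐ ω ∂P, rawIntegral σ t (fun s => W i s ω) = 0 := by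
  have hB := (hW.isBrownian i).toIsPreBrownianReal
  have hw := isWiener_rawIntegral hB hσ t
  have h1 := hw.integral_sq hB
  rw [integral_indicator_sq _ measurableSet_Iic] at h1
  have h2 : ∫ u in Set.Iic t, σ u ^ 2 = 0 :=
    le_antisymm ((monotone_energy hσ t.2.2).trans_eq h0) (integral_nonneg fun _ => sq_nonneg _)
  rw [h2, integral_eq_zero_iff_of_nonneg (fun _ => sq_nonneg _) hw.memLp.integrable_sq] at h1
  filter_upwards [h1] with ω hω
  simpa using hω

/-- The strictly stationary return curves are unique. -/
theorem IsSolution.ae_eq [IsProbabilityMeasure P] {g' : ℤ → Ω → ℝ} {R' : ℤ → unitInterval → Ω → ℝ}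
    (h : IsSolution P (q + 1) φ σ ε W g R) (hR : IsStrictlyStationary P R)
    (h' : IsSolution P (q + 1) φ σ ε W g' R') (hR' : IsStrictlyStationary P R')
    (hφ : IsCausal (q + 1) φ) (hσ : IsVolatility σ)
    (hε : IsWhiteNoise P ε) (hW : IsBrownianSequence P W) :
    ∀ᵐ ω ∂P, ∀ i t, R' i t ω = R i t ω := by
  have key (i : ℤ) (t : unitInterval) : ∀ᵐ ω ∂P, R' i t ω = R i t ω := by
    have h0 : 0 ≤ energy σ 1 := integral_nonneg fun _ => sq_nonneg _
    -- With zero energy both curves vanish, and nothing about `g` is needed.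
    rcases h0.eq_or_lt with h0 | h0
    · filter_upwards [h.ae_eq_mul_rawIntegral hσ hW i t, h'.ae_eq_mul_rawIntegral hσ hW i t,
        rawIntegral_ae_eq_zero hσ hW h0.symm i t] with ω h1 h2 h3
      rw [h1, h2, h3, mul_zero, mul_zero]
    · filter_upwards [h.ae_eq_mul_rawIntegral hσ hW i t, h'.ae_eq_mul_rawIntegral hσ hW i t,
        h.log_ae_eq hR hφ hσ hε hW h0 i, h'.log_ae_eq hR' hφ hσ hε hW h0 i,
        h.pos_g i, h'.pos_g i] with ω h1 h2 h3 h4 h5 h6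
      rw [h1, h2, Real.log_injOn_pos h6 h5 (h4.trans h3.symm)]
  -- Continuity extends agreement on a countable dense set to all times, off a single null set.
  obtain ⟨D, hDc, hD⟩ := TopologicalSpace.exists_countable_dense unitInterval
  have hall : ∀ᵐ ω ∂P, ∀ i, ∀ t ∈ D, R' i t ω = R i t ω := by
    rw [ae_all_iff]
    intro i
    rw [ae_ball_iff hDc]
    exact fun t _ => key i t
  filter_upwards [hall] with ω hω i t
  exact congrFun (Continuous.ext_on hD (h'.continuous_R i ω) (h.continuous_R i ω) (hω i)) t

end Model

/-! ### Identification of volatility function and volatility sequence -/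

lemma energy_one_pos {σ : unitInterval → ℝ} (hσ : IsVolatility σ)
    (h : 0 < volume {t : unitInterval | σ t ≠ 0}) : 0 < energy σ 1 := by
  rw [energy_one, integral_pos_iff_support_of_nonneg (fun _ => sq_nonneg _) hσ.integrable_sq]
  convert h using 2
  ext t
  simp

/-- The energy is the distribution function of the finite measure with density `σ²`. It determines
the measure, hence the density almost everywhere, and `σ ≥ 0` allows taking the root. -/
lemma ae_eq_of_energy_eq {σ σ' : unitInterval → ℝ} (hσ : IsVolatility σ) (hσ' : IsVolatility σ')
    (h : ∀ t, energy σ' t = energy σ t) : ∀ᵐ t : unitInterval, σ' t = σ t := by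
  have hm {σ : unitInterval → ℝ} (hσ : IsVolatility σ) :
      Measurable fun u => ENNReal.ofReal (σ u ^ 2) := (hσ.measurable.pow_const 2).ennreal_ofReal
  have hI {σ : unitInterval → ℝ} (hσ : IsVolatility σ) (t : unitInterval) :
      (volume.withDensity fun u => ENNReal.ofReal (σ u ^ 2)) (Set.Iic t) =
        ENNReal.ofReal (energy σ t) := by
    rw [withDensity_apply _ measurableSet_Iic, energy,
      ofReal_integral_eq_lintegral_ofReal hσ.integrable_sq.integrableOn
        (Eventually.of_forall fun _ => sq_nonneg _)]
  have hfin {σ : unitInterval → ℝ} (hσ : IsVolatility σ) :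
      ∫⁻ u, ENNReal.ofReal (σ u ^ 2) ≠ ∞ := by
    rw [← ofReal_integral_eq_lintegral_ofReal hσ.integrable_sq
      (Eventually.of_forall fun _ => sq_nonneg _)]
    exact ENNReal.ofReal_ne_top
  have hf : IsFiniteMeasure (volume.withDensity fun u => ENNReal.ofReal (σ' u ^ 2)) :=
    isFiniteMeasure_withDensity (hfin hσ')
  have heq : (volume.withDensity fun u => ENNReal.ofReal (σ' u ^ 2)) =
      volume.withDensity fun u => ENNReal.ofReal (σ u ^ 2) :=
    Measure.ext_of_Iic _ _ fun t => by rw [hI hσ', hI hσ, h]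
  rw [withDensity_eq_iff (hm hσ').aemeasurable (hm hσ).aemeasurable (hfin hσ')] at heq
  filter_upwards [heq] with u hu
  rw [ENNReal.ofReal_eq_ofReal_iff (sq_nonneg _) (sq_nonneg _)] at hu
  exact (pow_left_inj₀ (hσ'.nonneg u) (hσ.nonneg u) two_ne_zero).1 hu

section Model

variable {Ω : Type*} [MeasurableSpace Ω] {P : Measure Ω} {p q : ℕ} {φ : ℕ → ℝ}
  {σ : unitInterval → ℝ} {ε : ℤ → Ω → ℝ} {W : ℤ → ℝ≥0 → Ω → ℝ} {g : ℤ → Ω → ℝ}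
  {R : ℤ → unitInterval → Ω → ℝ}

lemma IsSolution.ae_quadVar_eq (h : IsSolution P p φ σ ε W g R) (hσ : IsVolatility σ)
    (hW : IsBrownianSequence P W) (i : ℤ) (t : unitInterval) :
    ∀ᵐ ω ∂P, quadVar t (fun s => R i s ω) = g i ω ^ 2 * energy σ t :=
  FunctionalSV.ae_quadVar_eq (hW.isBrownian i).toIsPreBrownianReal hσ
    (isWiener_rawIntegral (hW.isBrownian i).toIsPreBrownianReal hσ)
    (h.ae_eq_mul_rawIntegral hσ hW i) t

lemma IsStationaryModel.log_ae_eq [IsProbabilityMeasure P]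
    (h : IsStationaryModel P (q + 1) φ σ ε W g R) (hpos : 0 < energy σ 1) (i : ℤ) :
    ∀ᵐ ω ∂P, Real.log (g i ω) = arSolution q φ (fun j => ε j ω) i :=
  h.solution.log_ae_eq h.stationary h.causal h.volatility h.noise h.brownian hpos i

/-- The mean of the logarithm of the quadratic variation identifies the level of `σ`. -/
lemma IsStationaryModel.integral_log_quadVar [IsProbabilityMeasure P]
    (h : IsStationaryModel P p φ σ ε W g R) (hpos : 0 < energy σ 1) (i : ℤ) :
    ∫ ω, Real.log (quadVar 1 (fun s => R i s ω)) ∂P = Real.log (energy σ 1) := by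
  obtain ⟨q, rfl⟩ : ∃ q, p = q + 1 := ⟨p - 1, by have := h.causal.1; omega⟩
  -- `log (g² V(1)) = 2 log g + log V(1)`, and `log g` is the centred moving average.
  have h1 : ∫ ω, Real.log (quadVar 1 (fun s => R i s ω)) ∂P =
      ∫ ω, (2 * arSolution q φ (fun j => ε j ω) i + Real.log (energy σ 1)) ∂P := by
    refine integral_congr_ae ?_
    filter_upwards [h.solution.ae_quadVar_eq h.volatility h.brownian i 1, h.solution.pos_g i,
      h.log_ae_eq hpos i] with ω h1 h2 h3
    rw [h1, Real.log_mul (by positivity) hpos.ne', Real.log_pow, h3]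
    norm_num
  rw [h1, integral_add ((h.noise.integrable_arSolution h.causal i).const_mul 2)
    (integrable_const _), integral_const_mul, h.noise.integral_arSolution h.causal]
  simp

variable {Ω' : Type*} [MeasurableSpace Ω'] {P' : Measure Ω'} {p' : ℕ} {φ' : ℕ → ℝ}
  {σ' : unitInterval → ℝ} {ε' : ℤ → Ω' → ℝ} {W' : ℤ → ℝ≥0 → Ω' → ℝ} {g' : ℤ → Ω' → ℝ}
  {R' : ℤ → unitInterval → Ω' → ℝ}

/-- The law of a single return curve determines the integrated squared volatility. -/
theorem IsStationaryModel.energy_eq [IsProbabilityMeasure P] [IsProbabilityMeasure P']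
    (h : IsStationaryModel P p φ σ ε W g R) (h' : IsStationaryModel P' p' φ' σ' ε' W' g' R')
    (hpos : 0 < energy σ 1) (i : ℤ)
    (hlaw : P'.map (fun ω t => R' i t ω) = P.map (fun ω t => R i t ω)) (t : unitInterval) :
    energy σ' t = energy σ t := by
  have mR : Measurable fun ω t => R i t ω := measurable_pi_lambda _ (h.solution.measurable_R i)
  have mR' : Measurable fun ω t => R' i t ω := measurable_pi_lambda _ (h'.solution.measurable_R i)
  -- Almost sure properties of the curve depend on its law only.
  have transfer {S : Set (unitInterval → ℝ)} (hS : MeasurableSet S)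
      (h : ∀ᵐ ω ∂P, (fun s => R i s ω) ∈ S) : ∀ᵐ ω ∂P', (fun s => R' i s ω) ∈ S := by
    have h1 := (ae_map_iff mR.aemeasurable hS).2 h
    rw [← hlaw] at h1
    exact (ae_map_iff mR'.aemeasurable hS).1 h1
  -- The second volatility is not assumed nonzero; positivity of the quadratic variation is
  -- inherited from `R i`.
  have hpos' : 0 < energy σ' 1 := by
    have h1 := transfer (S := {F | 0 < quadVar 1 F})
      (measurableSet_lt measurable_const (measurable_quadVar 1)) (by
        filter_upwards [h.solution.ae_quadVar_eq h.volatility h.brownian i 1, h.solution.pos_g i]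
          with ω h1 h2
        rw [h1]
        positivity)
    obtain ⟨ω, h2, h3⟩ :=
      (h1.and (h'.solution.ae_quadVar_eq h'.volatility h'.brownian i 1)).exists
    have h2' : 0 < quadVar 1 fun s => R' i s ω := h2
    rw [h3] at h2'
    exact pos_of_mul_pos_right h2' (sq_nonneg _)
  have hone : energy σ' 1 = energy σ 1 := by
    refine Real.log_injOn_pos hpos' hpos ?_
    have mL : Measurable fun F => Real.log (quadVar 1 F) := (measurable_quadVar 1).log
    rw [← h.integral_log_quadVar hpos i, ← h'.integral_log_quadVar hpos' i,
      ← integral_map mR.aemeasurable mL.aestronglyMeasurable,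
      ← integral_map mR'.aemeasurable mL.aestronglyMeasurable, hlaw]
  -- The ratio of quadratic variations is free of `g`, so it is a deterministic feature of the law
  -- of the curve.
  have h1 := transfer (S := {F | quadVar t F = energy σ t / energy σ 1 * quadVar 1 F})
    (measurableSet_eq_fun (measurable_quadVar t) ((measurable_quadVar 1).const_mul _)) (by
      filter_upwards [h.solution.ae_quadVar_eq h.volatility h.brownian i 1,
        h.solution.ae_quadVar_eq h.volatility h.brownian i t] with ω h1 h2
      rw [h1, h2]
      field_simp)
  obtain ⟨ω, ⟨h2, h3⟩, h4, h5⟩ := ((h1.and (h'.solution.pos_g i)).and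
    ((h'.solution.ae_quadVar_eq h'.volatility h'.brownian i 1).and
      (h'.solution.ae_quadVar_eq h'.volatility h'.brownian i t))).exists
  have h2' : quadVar t (fun s => R' i s ω) =
    energy σ t / energy σ 1 * quadVar 1 (fun s => R' i s ω) := h2
  rw [h4, h5, hone] at h2'
  have h6 : g' i ω ^ 2 * energy σ' t = g' i ω ^ 2 * energy σ t := by
    rw [h2']
    field_simp
  exact mul_left_cancel₀ (pow_ne_zero 2 h3.ne') h6

/-- The volatility is a functional of the return curve. -/
lemma IsSolution.ae_eq_sqrt_quadVar (h : IsSolution P p φ σ ε W g R) (hσ : IsVolatility σ)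
    (hW : IsBrownianSequence P W) (hpos : 0 < energy σ 1) (i : ℤ) :
    ∀ᵐ ω ∂P, g i ω = √(quadVar 1 (fun s => R i s ω) / energy σ 1) := by
  filter_upwards [h.ae_quadVar_eq hσ hW i 1, h.pos_g i] with ω h1 h2
  rw [h1, mul_div_cancel_right₀ _ hpos.ne', Real.sqrt_sq h2.le]

end Model

end FunctionalSV

end

/-! ### Existence, uniqueness and identification combined. -/

theorem mainTheorem10
    {Ω : Type*} [MeasurableSpace Ω] (P : Measure Ω) [IsProbabilityMeasure P]
    (p : ℕ) (φ : ℕ → ℝ) (σ : unitInterval → ℝ) (ε : ℤ → Ω → ℝ) (W : ℤ → ℝ≥0 → Ω → ℝ)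
    (hφ : FunctionalSV.IsCausal p φ)
    (hσ : FunctionalSV.IsVolatility σ)
    (hε : FunctionalSV.IsWhiteNoise P ε)
    (hW : FunctionalSV.IsBrownianSequence P W)
    (hWε : IndepFun (fun ω i t => W i t ω) (fun ω i => ε i ω) P) :
    -- existence and uniqueness of the strictly stationary functional sequence
    (∃ (g : ℤ → Ω → ℝ) (R : ℤ → unitInterval → Ω → ℝ),
      FunctionalSV.IsSolution P p φ σ ε W g R ∧ FunctionalSV.IsStrictlyStationary P R ∧
      ∀ (g' : ℤ → Ω → ℝ) (R' : ℤ → unitInterval → Ω → ℝ),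
        FunctionalSV.IsSolution P p φ σ ε W g' R' → FunctionalSV.IsStrictlyStationary P R' →
        ∀ᵐ ω ∂P, ∀ i t, R' i t ω = R i t ω) ∧
    -- `g i` and `σ` are distinguishable: the law of the curve `R i` determines `σ`,
    -- and `g i` is then a function of the curve `R i`
    (0 < volume {t : unitInterval | σ t ≠ 0} →
      ∀ (g : ℤ → Ω → ℝ) (R : ℤ → unitInterval → Ω → ℝ),
      FunctionalSV.IsSolution P p φ σ ε W g R → FunctionalSV.IsStrictlyStationary P R →
      ∀ {Ω' : Type*} [MeasurableSpace Ω'] (P' : Measure Ω') [IsProbabilityMeasure P']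
        (p' : ℕ) (φ' : ℕ → ℝ) (σ' : unitInterval → ℝ) (ε' : ℤ → Ω' → ℝ) (W' : ℤ → ℝ≥0 → Ω' → ℝ)
        (g' : ℤ → Ω' → ℝ) (R' : ℤ → unitInterval → Ω' → ℝ),
      FunctionalSV.IsStationaryModel P' p' φ' σ' ε' W' g' R' →
      ∀ i, P'.map (fun ω t => R' i t ω) = P.map (fun ω t => R i t ω) →
        (∀ᵐ t : unitInterval, σ' t = σ t) ∧
        ∃ Γ : (unitInterval → ℝ) → ℝ, Measurable Γ ∧
          (∀ᵐ ω ∂P, g i ω = Γ (fun t => R i t ω)) ∧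
          (∀ᵐ ω ∂P', g' i ω = Γ (fun t => R' i t ω))) := by
  obtain ⟨q, rfl⟩ : ∃ q, p = q + 1 := ⟨p - 1, by have := hφ.1; omega⟩
  have hsol := FunctionalSV.isSolution_curveSolution hφ hσ hε hW hWε
  have hstat := FunctionalSV.isStrictlyStationary_curveSolution (q := q) (φ := φ) (σ := σ) hε hW hWε
  refine ⟨⟨_, _, hsol, hstat, fun g' R' h' hR' => hsol.ae_eq hstat h' hR' hφ hσ hε hW⟩, ?_⟩
  intro hvol g R h hR Ω' _ P' _ p' φ' σ' ε' W' g' R' h' i hlaw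
  have hpos := FunctionalSV.energy_one_pos hσ hvol
  have hmodel : FunctionalSV.IsStationaryModel P (q + 1) φ σ ε W g R := ⟨hφ, hσ, hε, hW, h, hR⟩
  have henergy := hmodel.energy_eq h' hpos i hlaw
  refine ⟨FunctionalSV.ae_eq_of_energy_eq hσ h'.volatility henergy,
    fun F => √(FunctionalSV.quadVar 1 F / FunctionalSV.energy σ 1),
    ((FunctionalSV.measurable_quadVar 1).div_const _).sqrt,
    h.ae_eq_sqrt_quadVar hσ hW hpos i, ?_⟩
  -- `Γ` is normalized by the energy of `σ`; as it equals that of `σ'`, the same functional recovers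
  -- `g'`.
  rw [← henergy 1]
  exact h'.solution.ae_eq_sqrt_quadVar h'.volatility h'.brownian (by rwa [henergy 1]) i
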